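/- Let $G$ be a simply connected real Lie group whose Lie algebra $\mathfrak g$ is $2$-step nilpotent, i.e. $[[\mathfrak g,\mathfrak g],\mathfrak g]=0$, and let $J$ be a left-invariant complex structure on $G$ (a left-invariant smooth endomorphism field of $TG$ with $J^2=-1$ and vanishing Nijenhuis tensor) such that $J[\mathfrak g,\mathfrak g]\subseteq[\mathfrak g,\mathfrak g]$. For a Riemannian metric $g$ with Levi-Civita Ricci tensor $\mathrm{Ric}(g)$, let $$\mathrm{Ric}^{1,1}(g)(X,Y)=\tfrac12\big(\mathrm{Ric}(g)(X,Y)+\mathrm{Ric}(g)(JX,JY)\big)$$ be its $(1,1)$-component. Then for every left-invariant Hermitian metric $g_0$ on $(G,J)$ the flow $$\partial_t g_t=-\mathrm{Ric}^{1,1}(g_t),\qquad g_t|_{t=0}=g_0,$$ has a solution $(g_t)_{t\in[0,\infty)}$ by left-invariant Hermitian metrics, smooth in $t$ and defined for all $t\ge 0$. -/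

import Mathlib

open Set VectorField
open scoped Manifold ContDiff Bundle

/-- A smooth (`C^∞`) Lie group over `ℝ` is smooth enough for Mathlib's Lie algebra structure on
`GroupLieAlgebra`. -/
instance leInfty_minSmoothness_three : ENat.LEInfty (minSmoothness ℝ 3) :=
  ⟨by rw [minSmoothness_of_isRCLikeNormedField]; exact ENat.LEInfty.out⟩

namespace HermitianFlow

section Manifold

variable {E : Type*} [NormedAddCommGroup E] [NormedSpace ℝ E] [FiniteDimensional ℝ E]
  [CompleteSpace E]
  {M : Type*} [TopologicalSpace M] [ChartedSpace E M] [IsManifold 𝓘(ℝ, E) ∞ M]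

/-- A smooth vector field on `M`. -/
def IsSmoothField (X : Π x : M, TangentSpace 𝓘(ℝ, E) x) : Prop :=
  ContMDiff 𝓘(ℝ, E) 𝓘(ℝ, E).tangent ∞ (fun x : M ↦ (⟨x, X x⟩ : TangentBundle 𝓘(ℝ, E) M))

/-- A vector field on `M` that is differentiable at the point `x`. -/
def IsDifferentiableFieldAt (X : Π x : M, TangentSpace 𝓘(ℝ, E) x) (x : M) : Prop :=
  MDifferentiableAt 𝓘(ℝ, E) 𝓘(ℝ, E).tangent
    (fun y : M ↦ (⟨y, X y⟩ : TangentBundle 𝓘(ℝ, E) M)) x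

variable (E M) in
/-- Smooth Riemannian metrics on `M`. -/
abbrev Metric : Type _ :=
  Bundle.ContMDiffRiemannianMetric 𝓘(ℝ, E) ∞ E (fun x : M ↦ TangentSpace 𝓘(ℝ, E) x)

variable (E M) in
/-- Affine connections on `M`; `cov Y x (X x)` is `(∇_X Y)(x)`. -/
abbrev Connection : Type _ :=
  CovariantDerivative 𝓘(ℝ, E) E (fun x : M ↦ TangentSpace 𝓘(ℝ, E) x)

/-- `J` is a complex structure on `M`: a smooth field of endomorphisms of the tangent spaces with
`J² = -1` and vanishing Nijenhuis tensor. -/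
structure IsComplexStructure
    (J : Π x : M, TangentSpace 𝓘(ℝ, E) x →L[ℝ] TangentSpace 𝓘(ℝ, E) x) : Prop where
  smooth : ContMDiff 𝓘(ℝ, E) (𝓘(ℝ, E).prod 𝓘(ℝ, E →L[ℝ] E)) ∞
    (fun x : M ↦ Bundle.TotalSpace.mk' (E →L[ℝ] E)
      (E := fun x : M ↦ TangentSpace 𝓘(ℝ, E) x →L[ℝ] TangentSpace 𝓘(ℝ, E) x) x (J x))
  sq : ∀ (x : M) (v : TangentSpace 𝓘(ℝ, E) x), J x (J x v) = -v
  nijenhuis : ∀ X Y : Π x : M, TangentSpace 𝓘(ℝ, E) x, IsSmoothField X → IsSmoothField Y →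
    ∀ x : M,
      mlieBracket 𝓘(ℝ, E) (fun y ↦ J y (X y)) (fun y ↦ J y (Y y)) x
        - J x (mlieBracket 𝓘(ℝ, E) (fun y ↦ J y (X y)) Y x)
        - J x (mlieBracket 𝓘(ℝ, E) X (fun y ↦ J y (Y y)) x)
        - mlieBracket 𝓘(ℝ, E) X Y x = 0

/-- The metric `g` is Hermitian with respect to `J`: `g(Jv, Jw) = g(v, w)`. -/
def IsHermitian (J : Π x : M, TangentSpace 𝓘(ℝ, E) x →L[ℝ] TangentSpace 𝓘(ℝ, E) x)
    (g : Metric E M) : Prop :=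
  ∀ (x : M) (v w : TangentSpace 𝓘(ℝ, E) x), g.inner x (J x v) (J x w) = g.inner x v w

/-- `cov` is the Levi-Civita connection of `g`: it is torsion-free, and
`v(g(Y, Z)) = g(∇_v Y, Z) + g(Y, ∇_v Z)`. -/
structure IsLeviCivita (g : Metric E M) (cov : Connection E M) : Prop where
  torsion_free : cov.torsion = 0
  metric : ∀ (Y Z : Π x : M, TangentSpace 𝓘(ℝ, E) x) (x : M),
    IsDifferentiableFieldAt Y x → IsDifferentiableFieldAt Z x →
    ∀ v : TangentSpace 𝓘(ℝ, E) x,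
      (mfderiv 𝓘(ℝ, E) 𝓘(ℝ, ℝ) (fun y : M ↦ g.inner y (Y y) (Z y)) x v : ℝ)
        = g.inner x (cov Y x v) (Z x) + g.inner x (Y x) (cov Z x v)

/-- The curvature `R(X, Y)Z = ∇_X ∇_Y Z - ∇_Y ∇_X Z - ∇_{[X, Y]} Z` of vector fields. -/
noncomputable def curvature (cov : Connection E M)
    (X Y Z : Π x : M, TangentSpace 𝓘(ℝ, E) x) (x : M) : TangentSpace 𝓘(ℝ, E) x :=
  cov (fun y ↦ cov Z y (Y y)) x (X x) - cov (fun y ↦ cov Z y (X y)) x (Y x)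
    - cov Z x (mlieBracket 𝓘(ℝ, E) X Y x)

/-- `R` is the curvature tensor of `cov`: `R x u v w = (R(X, Y)Z)(x)` for all smooth vector fields
`X, Y, Z` with values `u, v, w` at `x`. -/
def IsCurvatureTensor (cov : Connection E M)
    (R : Π x : M, TangentSpace 𝓘(ℝ, E) x →ₗ[ℝ] TangentSpace 𝓘(ℝ, E) x →ₗ[ℝ]
      TangentSpace 𝓘(ℝ, E) x →ₗ[ℝ] TangentSpace 𝓘(ℝ, E) x) : Prop :=
  ∀ X Y Z : Π x : M, TangentSpace 𝓘(ℝ, E) x,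
    IsSmoothField X → IsSmoothField Y → IsSmoothField Z →
    ∀ x : M, R x (X x) (Y x) (Z x) = curvature cov X Y Z x

/-- `Ric` is the Ricci tensor of `g`: `Ric(v, w)` is the trace of `u ↦ R(u, v)w`, with `R` the
curvature tensor of the Levi-Civita connection of `g`. -/
def IsRicciTensor (g : Metric E M)
    (Ric : Π x : M, TangentSpace 𝓘(ℝ, E) x →ₗ[ℝ] TangentSpace 𝓘(ℝ, E) x →ₗ[ℝ] ℝ) : Prop :=
  ∃ (cov : Connection E M)
    (R : Π x : M, TangentSpace 𝓘(ℝ, E) x →ₗ[ℝ] TangentSpace 𝓘(ℝ, E) x →ₗ[ℝ]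
      TangentSpace 𝓘(ℝ, E) x →ₗ[ℝ] TangentSpace 𝓘(ℝ, E) x),
    IsLeviCivita g cov ∧ IsCurvatureTensor cov R ∧
    ∀ (x : M) (v w : TangentSpace 𝓘(ℝ, E) x),
      Ric x v w = LinearMap.trace ℝ (TangentSpace 𝓘(ℝ, E) x) (((R x).flip v).flip w)

/-- The `(1,1)`-component (the `J`-invariant part) of a symmetric bilinear form field `B`. -/
noncomputable def part11
    (J : Π x : M, TangentSpace 𝓘(ℝ, E) x →L[ℝ] TangentSpace 𝓘(ℝ, E) x)
    (B : Π x : M, TangentSpace 𝓘(ℝ, E) x →ₗ[ℝ] TangentSpace 𝓘(ℝ, E) x →ₗ[ℝ] ℝ)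
    (x : M) (v w : TangentSpace 𝓘(ℝ, E) x) : ℝ :=
  (B x v w + B x (J x v) (J x w)) / 2

/-- The family `g t`, `t ≥ 0`, is a solution on `[0, ∞)`, smooth in time, of
`∂_t g_t = -Ric^{1,1}(g_t)` by Hermitian metrics (values at negative times are ignored). -/
structure IsLongTimeSolution
    (J : Π x : M, TangentSpace 𝓘(ℝ, E) x →L[ℝ] TangentSpace 𝓘(ℝ, E) x)
    (g : ℝ → Metric E M) : Prop where
  hermitian : ∀ t : ℝ, 0 ≤ t → IsHermitian J (g t)
  smooth : ∀ (x : M) (v w : TangentSpace 𝓘(ℝ, E) x),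
    ContDiffOn ℝ ∞ (fun t : ℝ ↦ (g t).inner x v w) (Ici 0)
  evolution : ∀ t : ℝ, 0 ≤ t →
    ∃ Ric : Π x : M, TangentSpace 𝓘(ℝ, E) x →ₗ[ℝ] TangentSpace 𝓘(ℝ, E) x →ₗ[ℝ] ℝ,
      IsRicciTensor (g t) Ric ∧
      ∀ (x : M) (v w : TangentSpace 𝓘(ℝ, E) x),
        HasDerivWithinAt (fun s : ℝ ↦ (g s).inner x v w) (-part11 J Ric x v w) (Ici 0) t

end Manifold

section LieGroup

variable {E : Type*} [NormedAddCommGroup E] [NormedSpace ℝ E] [FiniteDimensional ℝ E]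
  {G : Type*} [TopologicalSpace G] [ChartedSpace E G] [Group G]

/-- The endomorphism field `J` commutes with the differentials of all left translations. -/
def IsLeftInvariantEndo
    (J : Π x : G, TangentSpace 𝓘(ℝ, E) x →L[ℝ] TangentSpace 𝓘(ℝ, E) x) : Prop :=
  ∀ (a x : G) (v : TangentSpace 𝓘(ℝ, E) x),
    J (a * x) (mfderiv 𝓘(ℝ, E) 𝓘(ℝ, E) (fun y : G ↦ a * y) x v)
      = mfderiv 𝓘(ℝ, E) 𝓘(ℝ, E) (fun y : G ↦ a * y) x (J x v)

/-- All left translations are isometries of `g`. -/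
def IsLeftInvariantMetric [IsManifold 𝓘(ℝ, E) ∞ G] (g : Metric E G) : Prop :=
  ∀ (a x : G) (v w : TangentSpace 𝓘(ℝ, E) x),
    g.inner (a * x) (mfderiv 𝓘(ℝ, E) 𝓘(ℝ, E) (fun y : G ↦ a * y) x v)
        (mfderiv 𝓘(ℝ, E) 𝓘(ℝ, E) (fun y : G ↦ a * y) x w)
      = g.inner x v w

end LieGroup

end HermitianFlow

/-!
Left translations trivialize the tangent bundle, so left-invariant objects become linear algebra on
the Lie algebra. Choose the trivialization to be isometric for the initial metric: then `g₀` is the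
inner product of a Euclidean space `V` carrying a bracket `br`, the complex structure is an
orthogonal operator `J`, and the orthogonal projection `p` onto the commutator ideal, which is
central, commutes with `J`. The solution is sought among the metrics `⟪S ·, ·⟫` with
`S = (1 - p) H + p H⁻¹`, where `H` is a positive operator commuting with `J` and `p`.

The point of the substitution is `IsTwoStepData.ricciForm_metricOp`. For such a metric the Ricci
form is represented by `-((1 - p) N - p H⁻¹ N H⁻¹)`, where `N` is a quadratic expression in `H⁻¹`
(`bracketForm`) with coefficients depending on the bracket only. The derivative of `S` being
`(1 - p) H' - p H⁻¹ H' H⁻¹`, the flow is the single equation `H' = ½ (N + J* N J)` with `H = 1` at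
time zero (`IsTwoStepData.hasDerivAt_metricOp`). Here `N` is positive as soon as `H⁻¹` is
(`isPositive_bracketForm`): the operator `H` can only grow, and the condition `H ≥ 1` persists. As
`‖H⁻¹‖ ≤ 1` where `H ≥ 1`, the right-hand side is bounded and Lipschitz there, and the solution
exists for all `t ≥ 0` (`exists_forall_hasDerivAt_of_cone`, `IsTwoStepData.exists_flow`).

It remains to justify that `ricciForm` computes the Ricci tensor. This is done for any manifold with
a frame of fields whose brackets are constant combinations of the frame (`IsLieFraming`). In such a
frame the bracket of arbitrary fields is given by `IsLieFraming.apply_mlieBracket`, connections with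
constant coefficients have curvature with constant coefficients (`IsLieFraming.apply_curvature`),
and the Koszul formula yields the Levi-Civita connection of a constant metric
(`IsLieFraming.isLeviCivita`, `IsLieFraming.exists_isRicciTensor`). The curvature computation rests
on `[X, Y] f = X (Y f) - Y (X f)`, which is extracted from the Jacobi identity for `X`, `Y` and
`f • Z` (`mvfderiv_mlieBracket_of_ne_zero`). The left-invariant fields of a Lie group form such a
frame (`isLieFraming_leftFraming`).
-/

namespace HermitianFlow

/-! ### Differential equations in cones -/

section ODE

/-- Nearest-point projection onto a closed convex set, transported from a Euclidean structure. -/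
theorem exists_lipschitz_retraction {P : Type*} [NormedAddCommGroup P] [NormedSpace ℝ P]
    [FiniteDimensional ℝ P] {K : Set P} (hne : K.Nonempty) (hcl : IsClosed K)
    (hconv : Convex ℝ K) :
    ∃ (r : P → P) (c : NNReal), LipschitzWith c r ∧ (∀ x, r x ∈ K) ∧ ∀ x ∈ K, r x = x := by
  let ψ : P ≃L[ℝ] EuclideanSpace ℝ (Fin (Module.finrank ℝ P)) := toEuclidean
  let K' : Set (EuclideanSpace ℝ (Fin (Module.finrank ℝ P))) := ψ.symm ⁻¹' K
  have hne' : K'.Nonempty := by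
    obtain ⟨x, hx⟩ := hne
    exact ⟨ψ x, by simpa [K'] using hx⟩
  have hcl' : IsClosed K' := hcl.preimage ψ.symm.continuous
  have hconv' : Convex ℝ K' := hconv.linear_preimage ψ.symm.toLinearMap
  choose pr hprK hpr using exists_norm_eq_iInf_of_complete_convex hne' hcl'.isComplete hconv'
  have key : ∀ u, ∀ w ∈ K', inner ℝ (u - pr u) (w - pr u) ≤ 0 := fun u ↦
    (norm_eq_iInf_iff_real_inner_le_zero hconv' (hprK u)).1 (hpr u)
  have hlip : LipschitzWith 1 pr := by
    refine LipschitzWith.of_dist_le_mul fun u v ↦ ?_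
    rw [NNReal.coe_one, one_mul, dist_eq_norm, dist_eq_norm]
    have h1 := key u _ (hprK v)
    have h2 := key v _ (hprK u)
    have h3 : inner ℝ (pr u - pr v) (pr u - pr v) ≤ inner ℝ (u - v) (pr u - pr v) := by
      have e1 : u - pr u = (u - v) + (v - pr v) - (pr u - pr v) := by abel
      have e2 : pr v - pr u = -(pr u - pr v) := by abel
      rw [e1, e2, inner_neg_right, inner_sub_left, inner_add_left] at h1
      linarith
    have h4 := real_inner_le_norm (u - v) (pr u - pr v)
    rw [real_inner_self_eq_norm_sq] at h3
    by_contra! h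
    have h5 : 0 < ‖pr u - pr v‖ := (norm_nonneg _).trans_lt h
    nlinarith
  have hfix : ∀ u ∈ K', pr u = u := by
    intro u hu
    have := key u u hu
    rw [real_inner_self_nonpos, sub_eq_zero] at this
    exact this.symm
  refine ⟨fun x ↦ ψ.symm (pr (ψ x)), _, (ψ.symm.lipschitz.comp (hlip.comp ψ.lipschitz)),
    fun x ↦ hprK (ψ x), fun x hx ↦ ?_⟩
  change ψ.symm (pr (ψ x)) = x
  rw [hfix (ψ x) (by simpa [K'] using hx)]
  simp

/-- A bounded Lipschitz vector field has a trajectory through each point that is defined for all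
times: boundedness makes the Picard-Lindelöf theorem apply on every interval. -/
theorem exists_forall_hasDerivAt_of_lipschitz_of_bounded {P : Type*} [NormedAddCommGroup P]
    [NormedSpace ℝ P] [CompleteSpace P] {f : P → P} {c C : NNReal} (hf : LipschitzWith c f)
    (hb : ∀ x, ‖f x‖ ≤ C) (x₀ : P) :
    ∃ x : ℝ → P, x 0 = x₀ ∧ ∀ t, HasDerivAt x (f (x t)) t := by
  -- On `(-(n + 1), n + 1)` the trajectory stays in the ball of radius `C * (n + 1)`.
  have loc : ∀ n : ℕ, ∃ x : ℝ → P, x 0 = x₀ ∧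
      ∀ t ∈ Ioo (-(n + 1 : ℝ)) (n + 1), HasDerivAt x (f (x t)) t := by
    intro n
    have h0 : (0 : ℝ) ∈ Icc (-(n + 1 : ℝ)) (n + 1) := by
      constructor <;> linarith [n.cast_nonneg (α := ℝ)]
    have hpl : IsPicardLindelof (fun _ ↦ f) (⟨0, h0⟩ : Icc (-(n + 1 : ℝ)) (n + 1)) x₀
        (C * (n + 1)) 0 C c :=
      { lipschitzOnWith := fun _ _ ↦ hf.lipschitzOnWith
        continuousOn := fun _ _ ↦ continuousOn_const
        norm_le := fun _ _ x _ ↦ hb x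
        mul_max_le := by simp }
    obtain ⟨x, hx0, hx⟩ := hpl.exists_eq_forall_mem_Icc_hasDerivWithinAt₀
    exact ⟨x, hx0, fun t ht ↦ (hx t (Ioo_subset_Icc_self ht)).hasDerivAt
      (Icc_mem_nhds ht.1 ht.2)⟩
  choose x hx0 hx using loc
  have agree : ∀ m n : ℕ, m ≤ n → EqOn (x m) (x n) (Ioo (-(m + 1 : ℝ)) (m + 1)) := by
    intro m n hmn
    have hmn' : (m : ℝ) ≤ n := by exact_mod_cast hmn
    refine ODE_solution_unique_of_mem_Ioo (v := fun _ ↦ f) (s := fun _ ↦ univ) (K := c) (t₀ := 0)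
      (fun _ _ ↦ hf.lipschitzOnWith) ?_ (fun t ht ↦ ⟨hx m t ht, mem_univ _⟩)
      (fun t ht ↦ ⟨hx n t ?_, mem_univ _⟩) ((hx0 m).trans (hx0 n).symm)
    · constructor <;> linarith [m.cast_nonneg (α := ℝ)]
    · exact ⟨by linarith [ht.1], by linarith [ht.2]⟩
  -- The local trajectories agree where they overlap, so they glue; near `t` the glued curve is the
  -- one with index `⌈|t|⌉₊`.
  refine ⟨fun t ↦ x ⌈|t|⌉₊ t, by simpa using hx0 0, fun t ↦ ?_⟩
  have mem : ∀ s : ℝ, ∀ n : ℕ, |s| < n + 1 → s ∈ Ioo (-(n + 1 : ℝ)) (n + 1) := fun s n h ↦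
    abs_lt.1 h
  have ht : |t| < (⌈|t|⌉₊ : ℝ) + 1 := (Nat.le_ceil _).trans_lt (lt_add_one _)
  have hev : (fun s ↦ x ⌈|s|⌉₊ s) =ᶠ[nhds t] x ⌈|t|⌉₊ := by
    filter_upwards [Ioo_mem_nhds (mem t _ ht).1 (mem t _ ht).2] with s hs
    have hs' : |s| < (⌈|s|⌉₊ : ℝ) + 1 := (Nat.le_ceil _).trans_lt (lt_add_one _)
    rcases le_total ⌈|s|⌉₊ ⌈|t|⌉₊ with h | h
    · exact agree _ _ h (mem s _ hs')
    · exact (agree _ _ h hs).symm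
  exact (hx _ t (mem t _ ht)).congr_of_eventuallyEq hev

/-- If `f` maps the translated cone `x₀ + C` into `C`, the trajectory of `f` through `x₀` cannot
leave `x₀ + C`, so boundedness and the Lipschitz property of `f` there give a global solution. -/
theorem exists_forall_hasDerivAt_of_cone {P : Type*} [NormedAddCommGroup P] [NormedSpace ℝ P]
    [FiniteDimensional ℝ P] (C : ProperCone ℝ P) (x₀ : P) {f : P → P} {c B : NNReal}
    (hf : LipschitzOnWith c f {x | x - x₀ ∈ C}) (hb : ∀ x, x - x₀ ∈ C → ‖f x‖ ≤ B)
    (hC : ∀ x, x - x₀ ∈ C → f x ∈ C) :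
    ∃ x : ℝ → P, x 0 = x₀ ∧ ∀ t, 0 ≤ t → x t - x₀ ∈ C ∧ HasDerivAt x (f (x t)) t := by
  have : CompleteSpace P := FiniteDimensional.complete ℝ P
  have hcl : IsClosed {x | x - x₀ ∈ C} :=
    C.isClosed.preimage (continuous_id.sub continuous_const)
  have hconv : Convex ℝ {x | x - x₀ ∈ C} := by
    have := C.convex.translate_preimage_left (-x₀)
    convert this using 1
    ext x
    simp [sub_eq_add_neg]
  -- Composed with a retraction onto the translated cone, the field is bounded and Lipschitz
  -- everywhere.
  obtain ⟨r, k, hr, hrK, hfix⟩ := exists_lipschitz_retraction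
    (K := {x | x - x₀ ∈ C}) ⟨x₀, by simp⟩ hcl hconv
  have hlip : LipschitzWith (c * k) (f ∘ r) := by
    rw [← lipschitzOnWith_univ] at hr ⊢
    exact hf.comp hr fun x _ ↦ hrK x
  obtain ⟨x, hx0, hx⟩ := exists_forall_hasDerivAt_of_lipschitz_of_bounded hlip
    (C := B) (fun x ↦ hb _ (hrK x)) x₀
  have hmem : ∀ t, 0 ≤ t → x t - x₀ ∈ C := by
    intro t ht
    -- A linear functional separating the trajectory from the cone would be nonnegative on the cone,
    -- hence nondecreasing along the trajectory, and yet negative at time `t`.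
    by_contra hcon
    obtain ⟨ℓ, hℓ, hneg⟩ := C.hyperplane_separation_point hcon
    have hd : ∀ s, HasDerivAt (fun s ↦ ℓ (x s)) (ℓ (f (r (x s)))) s := fun s ↦
      ℓ.hasFDerivAt.comp_hasDerivAt s (hx s)
    have hmono : Monotone fun s ↦ ℓ (x s) :=
      monotone_of_deriv_nonneg (fun s ↦ (hd s).differentiableAt) fun s ↦ by
        rw [(hd s).deriv]
        exact hℓ _ (hC _ (hrK _))
    have := hmono ht
    simp only [hx0] at this
    rw [map_sub] at hneg
    linarith
  refine ⟨x, hx0, fun t ht ↦ ⟨hmem t ht, ?_⟩⟩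
  have := hx t
  rwa [Function.comp_apply, hfix _ (hmem t ht)] at this

/-- Bootstrapping: a trajectory of a smooth field is smooth. The field need not be smooth outside
the set `U` containing the trajectory. -/
theorem contDiffOn_Ici_of_hasDerivAt {P : Type*} [NormedAddCommGroup P] [NormedSpace ℝ P]
    {f : P → P} {x : ℝ → P} {U : Set P} (hf : ContDiffOn ℝ ∞ f U) (hU : ∀ t, 0 ≤ t → x t ∈ U)
    (hx : ∀ t, 0 ≤ t → HasDerivAt x (f (x t)) t) : ContDiffOn ℝ ∞ x (Ici 0) := by
  rw [contDiffOn_infty]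
  intro n
  induction n with
  | zero =>
    rw [Nat.cast_zero, contDiffOn_zero]
    exact fun t ht ↦ (hx t ht).continuousAt.continuousWithinAt
  | succ n ih =>
    rw [Nat.cast_add, Nat.cast_one, contDiffOn_succ_iff_derivWithin (uniqueDiffOn_Ici 0)]
    refine ⟨fun t ht ↦ (hx t ht).differentiableAt.differentiableWithinAt, by simp, ?_⟩
    have h : ContDiffOn ℝ n (f ∘ x) (Ici 0) :=
      (hf.of_le (by exact_mod_cast le_top)).comp ih hU
    exact h.congr fun t ht ↦ (hx t ht).hasDerivWithinAt.derivWithin (uniqueDiffOn_Ici 0 t ht)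

end ODE

/-! ### Positive operators -/

section Operators

variable {V : Type*} [NormedAddCommGroup V] [InnerProductSpace ℝ V]

/-- The trace, as a linear functional on continuous endomorphisms. -/
noncomputable def opTrace : (V →L[ℝ] V) →ₗ[ℝ] ℝ :=
  LinearMap.trace ℝ V ∘ₗ ContinuousLinearMap.coeLM ℝ

theorem opTrace_mul_comm (S T : V →L[ℝ] V) : opTrace (S * T) = opTrace (T * S) :=
  LinearMap.trace_mul_comm ℝ (S : V →ₗ[ℝ] V) (T : V →ₗ[ℝ] V)

theorem opTrace_eq_sum {ι : Type*} [Fintype ι] (e : OrthonormalBasis ι ℝ V) (T : V →L[ℝ] V) :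
    opTrace T = ∑ i, inner ℝ (e i) (T (e i)) :=
  LinearMap.trace_eq_sum_inner (T : V →ₗ[ℝ] V) e

/-- A bilinear expression `∑ f (T eᵢ) eᵢ` over an orthonormal basis, with the operator moved to the
other argument. -/
theorem sum_apply_left_eq_sum_apply_star_right [CompleteSpace V] {W ι : Type*} [AddCommGroup W]
    [Module ℝ W] [Fintype ι] (e : OrthonormalBasis ι ℝ V) (f : V →ₗ[ℝ] V →ₗ[ℝ] W)
    (T : V →L[ℝ] V) :
    ∑ i, f (T (e i)) (e i) = ∑ i, f (e i) (star T (e i)) := by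
  have h1 : ∀ i, T (e i) = ∑ j, inner ℝ (e j) (T (e i)) • e j := fun i ↦ (e.sum_repr' _).symm
  have h2 : ∀ i, star T (e i) = ∑ j, inner ℝ (e j) (star T (e i)) • e j := fun i ↦
    (e.sum_repr' _).symm
  have h3 : ∀ i j, inner ℝ (e j) (star T (e i)) = inner ℝ (e i) (T (e j)) := fun i j ↦ by
    rw [ContinuousLinearMap.star_eq_adjoint, ContinuousLinearMap.adjoint_inner_right,
      real_inner_comm]
  calc ∑ i, f (T (e i)) (e i) = ∑ i, ∑ j, inner ℝ (e j) (T (e i)) • f (e j) (e i) := by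
        refine Finset.sum_congr rfl fun i _ ↦ ?_
        conv_lhs => rw [h1 i]
        simp [map_sum]
    _ = ∑ i, ∑ j, inner ℝ (e i) (T (e j)) • f (e i) (e j) := Finset.sum_comm
    _ = ∑ i, f (e i) (star T (e i)) := by
        refine Finset.sum_congr rfl fun i _ ↦ ?_
        conv_rhs => rw [h2 i]
        simp [map_sum, h3]

theorem opTrace_star [FiniteDimensional ℝ V] [CompleteSpace V] (T : V →L[ℝ] V) :
    opTrace (star T) = opTrace T := by
  rw [opTrace_eq_sum (stdOrthonormalBasis ℝ V), opTrace_eq_sum (stdOrthonormalBasis ℝ V)]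
  refine Finset.sum_congr rfl fun i _ ↦ ?_
  rw [ContinuousLinearMap.star_eq_adjoint, ContinuousLinearMap.adjoint_inner_right,
    real_inner_comm]

/-- A positive operator is a sum of rank-one operators `⟪u, ·⟫ u`, so its contraction with a
bilinear map is a sum of diagonal values. -/
theorem exists_sum_apply_left_eq_of_isPositive [FiniteDimensional ℝ V] {T : V →L[ℝ] V}
    (hT : T.IsPositive) :
    ∃ (m : ℕ) (u : Fin m → V), ∀ {W ι : Type _} [AddCommGroup W] [Module ℝ W] [Fintype ι]
      (e : OrthonormalBasis ι ℝ V) (f : V →ₗ[ℝ] V →ₗ[ℝ] W),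
      ∑ i, f (T (e i)) (e i) = ∑ j, f (u j) (u j) := by
  obtain ⟨m, u, hu⟩ := ContinuousLinearMap.isPositive_iff_eq_sum_rankOne.1 hT
  refine ⟨m, u, fun {W ι} _ _ _ e f ↦ ?_⟩
  have h : ∀ i, f (T (e i)) (e i) = ∑ j, f (u j) (inner ℝ (e i) (u j) • e i) := fun i ↦ by
    rw [hu]
    simp [LinearMap.sum_apply, real_inner_comm]
  simp_rw [h]
  rw [Finset.sum_comm]
  refine Finset.sum_congr rfl fun j _ ↦ ?_
  rw [← map_sum, e.sum_repr']

/-- The operators `T ≥ 0` commuting with `J` and `p`, as a closed convex cone. -/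
noncomputable def commutingPositiveCone (J p : V →L[ℝ] V) : ProperCone ℝ (V →L[ℝ] V) where
  carrier := {T | T.IsPositive ∧ Commute T J ∧ Commute T p}
  add_mem' hS hT := ⟨hS.1.add hT.1, hS.2.1.add_left hT.2.1, hS.2.2.add_left hT.2.2⟩
  zero_mem' := ⟨ContinuousLinearMap.isPositive_zero, Commute.zero_left _, Commute.zero_left _⟩
  smul_mem' c T hT := ⟨hT.1.smul_of_nonneg c.2, hT.2.1.smul_left (c : ℝ),
    hT.2.2.smul_left (c : ℝ)⟩
  isClosed' := by
    have h1 : IsClosed {T : V →L[ℝ] V | T.IsPositive} := by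
      have : {T : V →L[ℝ] V | T.IsPositive} =
          (⋂ (x : V) (y : V), {T : V →L[ℝ] V | inner ℝ (T x) y = inner ℝ x (T y)}) ∩
            ⋂ x : V, {T : V →L[ℝ] V | 0 ≤ inner ℝ (T x) x} := by
        ext T
        simp only [mem_ofPred_eq, mem_inter_iff, mem_iInter, ContinuousLinearMap.isPositive_iff]
        rfl
      rw [this]
      refine IsClosed.inter (isClosed_iInter fun x ↦ isClosed_iInter fun y ↦
        isClosed_eq (by fun_prop) (by fun_prop)) (isClosed_iInter fun x ↦
        isClosed_le (by fun_prop) (by fun_prop))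
    have h2 : ∀ S : V →L[ℝ] V, IsClosed {T : V →L[ℝ] V | Commute T S} := fun S ↦
      isClosed_eq (continuous_id.mul continuous_const) (continuous_const.mul continuous_id)
    exact h1.inter ((h2 J).inter (h2 p))

/-- `X` is the inverse of `H`, is positive and does not increase norms, as is the case when
`H ≥ 1`. -/
structure IsExpandingPair (H X : V →L[ℝ] V) : Prop where
  mul_right : H * X = 1
  mul_left : X * H = 1
  norm_le : ‖X‖ ≤ 1
  inverse_pos : X.IsPositive

/-- An operator `H ≥ 1` satisfies `‖v‖ ^ 2 ≤ ⟪H v, v⟫`, so it is coercive, hence invertible. -/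
theorem isExpandingPair_inverse [CompleteSpace V] {H : V →L[ℝ] V} (hH : (H - 1).IsPositive) :
    IsUnit H ∧ IsExpandingPair H (Ring.inverse H) := by
  have h1 : ∀ v, ‖v‖ * ‖v‖ ≤ inner ℝ (H v) v := fun v ↦ by
    have := hH.inner_nonneg_left v
    rw [sub_apply, inner_sub_left] at this
    rw [← real_inner_self_eq_norm_mul_norm]
    simpa using this
  have hu : IsUnit H := by
    refine ContinuousLinearMap.isUnit_of_forall_le_norm_inner_map H (c := 1) one_pos fun v ↦ ?_
    have := (h1 v).trans (le_abs_self _)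
    rw [Real.norm_eq_abs]
    simpa [sq] using this
  have hr := Ring.mul_inverse_cancel H hu
  have hl := Ring.inverse_mul_cancel H hu
  have hr' : ∀ v, H (Ring.inverse H v) = v := fun v ↦ congr($hr v)
  refine ⟨hu, hr, hl, ContinuousLinearMap.opNorm_le_bound _ zero_le_one fun v ↦ ?_, ?_⟩
  · have h2 := h1 (Ring.inverse H v)
    rw [hr'] at h2
    have h3 := h2.trans (real_inner_le_norm _ _)
    rw [one_mul]
    by_contra! h
    have := (norm_nonneg v).trans_lt h
    nlinarith
  · rw [ContinuousLinearMap.isPositive_iff]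
    have hHs : ∀ x y, inner ℝ (H x) y = inner ℝ x (H y) := fun x y ↦ by
      have := hH.inner_left_eq_inner_right x y
      simpa [inner_sub_left, inner_sub_right] using this
    refine ⟨fun x y ↦ ?_, fun x ↦ ?_⟩
    · change inner ℝ (Ring.inverse H x) y = inner ℝ x (Ring.inverse H y)
      conv_lhs => rw [← hr' y, ← hHs, hr']
    · have := (mul_self_nonneg _).trans (h1 (Ring.inverse H x))
      rwa [hr', real_inner_comm] at this

end Operators

/-! ### The flow of operators -/

section InverseForm

variable {A : Type*} [NormedRing A] [NormedAlgebra ℝ A] (B : A →L[ℝ] A →L[ℝ] A) (a b : A)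

/-- Inversion is `1`-Lipschitz where the inverse has norm at most `1`; hence so is, up to a
constant, any quadratic expression in the inverse. -/
theorem exists_lipschitzOnWith_inverse_form {K : Set A}
    (hK : ∀ H ∈ K, IsUnit H ∧ ‖Ring.inverse H‖ ≤ 1) : ∃ c : NNReal,
    LipschitzOnWith c (fun H ↦ (1 / 2 : ℝ) • (B (Ring.inverse H) (Ring.inverse H)
      + a * B (Ring.inverse H) (Ring.inverse H) * b)) K := by
  let D : ℝ := 1 / 2 * (2 * ‖B‖ + ‖a‖ * (2 * ‖B‖) * ‖b‖)
  have hD : 0 ≤ D := by positivity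
  refine ⟨⟨D, hD⟩, LipschitzOnWith.of_dist_le_mul fun H hH G hG ↦ ?_⟩
  have hXH := Ring.inverse_mul_cancel H (hK H hH).1
  have hGY := Ring.mul_inverse_cancel G (hK G hG).1
  have hX := (hK H hH).2
  have hY := (hK G hG).2
  rw [dist_eq_norm, dist_eq_norm]
  change _ ≤ D * ‖H - G‖
  set X := Ring.inverse H
  set Y := Ring.inverse G
  have h1 : X - Y = X * (G - H) * Y := by
    rw [mul_sub, sub_mul, hXH, one_mul, mul_assoc, hGY, mul_one]
  have h2 : ‖X - Y‖ ≤ ‖H - G‖ := by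
    rw [h1]
    calc ‖X * (G - H) * Y‖ ≤ ‖X‖ * ‖G - H‖ * ‖Y‖ := norm_mul₃_le
      _ ≤ 1 * ‖G - H‖ * 1 := by gcongr
      _ = ‖H - G‖ := by rw [one_mul, mul_one, norm_sub_rev]
  have h3 : ‖B X X - B Y Y‖ ≤ 2 * ‖B‖ * ‖H - G‖ := by
    have e : B X X - B Y Y = B (X - Y) X + B Y (X - Y) := by
      simp [map_sub, sub_apply]
    rw [e]
    calc ‖B (X - Y) X + B Y (X - Y)‖ ≤ ‖B‖ * ‖X - Y‖ * ‖X‖ + ‖B‖ * ‖Y‖ * ‖X - Y‖ :=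
          (norm_add_le _ _).trans (add_le_add (B.le_opNorm₂ _ _) (B.le_opNorm₂ _ _))
      _ ≤ ‖B‖ * ‖H - G‖ * 1 + ‖B‖ * 1 * ‖H - G‖ := by gcongr
      _ = 2 * ‖B‖ * ‖H - G‖ := by ring
  have e : (1 / 2 : ℝ) • (B X X + a * B X X * b) - (1 / 2 : ℝ) • (B Y Y + a * B Y Y * b)
      = (1 / 2 : ℝ) • ((B X X - B Y Y) + a * (B X X - B Y Y) * b) := by
    rw [← smul_sub, mul_sub, sub_mul]
    congr 1
    abel
  rw [e, norm_smul, Real.norm_of_nonneg (by norm_num)]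
  calc 1 / 2 * ‖(B X X - B Y Y) + a * (B X X - B Y Y) * b‖
      ≤ 1 / 2 * (‖B X X - B Y Y‖ + ‖a‖ * ‖B X X - B Y Y‖ * ‖b‖) := by
        gcongr
        exact (norm_add_le _ _).trans (by gcongr; exact norm_mul₃_le)
    _ ≤ 1 / 2 * (2 * ‖B‖ * ‖H - G‖ + ‖a‖ * (2 * ‖B‖ * ‖H - G‖) * ‖b‖) := by gcongr
    _ = D * ‖H - G‖ := by ring

/-- A quadratic expression in the inverse is bounded where the inverse has norm at most `1`. -/
theorem exists_norm_inverse_form_le {K : Set A} (hK : ∀ H ∈ K, ‖Ring.inverse H‖ ≤ 1) :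
    ∃ C : NNReal, ∀ H ∈ K, ‖(1 / 2 : ℝ) • (B (Ring.inverse H) (Ring.inverse H)
      + a * B (Ring.inverse H) (Ring.inverse H) * b)‖ ≤ C := by
  have hD : 0 ≤ 1 / 2 * (‖B‖ + ‖a‖ * ‖B‖ * ‖b‖) := by positivity
  refine ⟨⟨_, hD⟩, fun H hH ↦ ?_⟩
  have hX := hK H hH
  change _ ≤ 1 / 2 * (‖B‖ + ‖a‖ * ‖B‖ * ‖b‖)
  set X := Ring.inverse H
  have h3 : ‖B X X‖ ≤ ‖B‖ := by
    calc ‖B X X‖ ≤ ‖B‖ * ‖X‖ * ‖X‖ := B.le_opNorm₂ _ _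
      _ ≤ ‖B‖ * 1 * 1 := by gcongr
      _ = ‖B‖ := by ring
  rw [norm_smul, Real.norm_of_nonneg (by norm_num)]
  gcongr
  calc ‖B X X + a * B X X * b‖ ≤ ‖B X X‖ + ‖a‖ * ‖B X X‖ * ‖b‖ :=
        (norm_add_le _ _).trans (by gcongr; exact norm_mul₃_le)
    _ ≤ _ := by gcongr

theorem contDiffOn_inverse_form [CompleteSpace A] :
    ContDiffOn ℝ ∞ (fun H ↦ (1 / 2 : ℝ) • (B (Ring.inverse H) (Ring.inverse H)
      + a * B (Ring.inverse H) (Ring.inverse H) * b)) {H | IsUnit H} := by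
  intro H hH
  obtain ⟨u, rfl⟩ := hH
  have h1 : ContDiffAt ℝ ∞ Ring.inverse (u : A) := contDiffAt_ringInverse ℝ u
  have h2 : ContDiffAt ℝ ∞ (fun H : A ↦ B (Ring.inverse H) (Ring.inverse H)) (u : A) :=
    (B.contDiff.contDiffAt.comp _ h1).clm_apply h1
  exact (((h2.add ((contDiffAt_const.mul h2).mul contDiffAt_const)).const_smul _)).contDiffWithinAt

end InverseForm

section Nilpotent

set_option linter.unusedSectionVars false

variable {V : Type*} [NormedAddCommGroup V] [InnerProductSpace ℝ V] [FiniteDimensional ℝ V]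
  [CompleteSpace V]

/-- A 2-step nilpotent bracket `br` on a Euclidean space, an orthogonal complex structure `J`, and
the orthogonal projection `p` onto a central `J`-invariant subspace containing all brackets. -/
structure IsTwoStepData (br : V →L[ℝ] V →L[ℝ] V) (J p : V →L[ℝ] V) : Prop where
  skew : ∀ u v, br u v = -br v u
  star_p : star p = p
  p_mul_self : p * p = p
  p_mul : ∀ u, p * br u = br u
  mul_p : ∀ u, br u * p = 0
  star_J : star J = -J
  J_mul_self : J * J = -1
  J_comm : Commute J p

variable (br : V →L[ℝ] V →L[ℝ] V) (J p : V →L[ℝ] V)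

/-- The bilinear map `(X, Y) ↦ ∑ᵢ (½ ad(X eᵢ)* Y ad(eᵢ) + ¼ ad(X eᵢ) Y ad(eᵢ)*)` over an
orthonormal basis `eᵢ`. -/
noncomputable def bracketForm : (V →L[ℝ] V) →L[ℝ] (V →L[ℝ] V) →L[ℝ] (V →L[ℝ] V) :=
  (LinearMap.mk₂ ℝ (fun X Y : V →L[ℝ] V ↦
      ∑ i, ((1 / 2 : ℝ) • (star (br (X (stdOrthonormalBasis ℝ V i))) * Y *
          br (stdOrthonormalBasis ℝ V i))
        + (1 / 4 : ℝ) • (br (X (stdOrthonormalBasis ℝ V i)) * Y *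
          star (br (stdOrthonormalBasis ℝ V i)))))
    (fun X X' Y ↦ by
      rw [← Finset.sum_add_distrib]
      refine Finset.sum_congr rfl fun i _ ↦ ?_
      rw [add_apply, map_add, star_add]
      simp only [add_mul, smul_add]
      abel)
    (fun c X Y ↦ by
      rw [Finset.smul_sum]
      refine Finset.sum_congr rfl fun i _ ↦ ?_
      rw [smul_apply, map_smul, star_smul, star_trivial c]
      simp only [smul_mul_assoc, smul_add, smul_comm c])
    (fun X Y Y' ↦ by
      rw [← Finset.sum_add_distrib]
      refine Finset.sum_congr rfl fun i _ ↦ ?_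
      simp only [add_mul, mul_add, smul_add]
      abel)
    (fun c X Y ↦ by
      rw [Finset.smul_sum]
      refine Finset.sum_congr rfl fun i _ ↦ ?_
      simp only [smul_mul_assoc, mul_smul_comm, smul_add, smul_comm c])).toContinuousBilinearMap

theorem bracketForm_apply (X Y : V →L[ℝ] V) : bracketForm br X Y =
    ∑ i, ((1 / 2 : ℝ) • (star (br (X (stdOrthonormalBasis ℝ V i))) * Y *
          br (stdOrthonormalBasis ℝ V i))
        + (1 / 4 : ℝ) • (br (X (stdOrthonormalBasis ℝ V i)) * Y *
          star (br (stdOrthonormalBasis ℝ V i)))) := rfl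

/-- The velocity `½ (N + J* N J)` of the flow in the operator coordinate `H`, where `N` is the value
of `bracketForm` at `H⁻¹`. The inverse is `Ring.inverse`, which is `0` at non-invertible `H`. -/
noncomputable def flowField (H : V →L[ℝ] V) : V →L[ℝ] V :=
  (1 / 2 : ℝ) • (bracketForm br (Ring.inverse H) (Ring.inverse H)
    + star J * bracketForm br (Ring.inverse H) (Ring.inverse H) * J)

variable {br J p}

/-- Writing `X` as a sum of operators `⟪u, ·⟫ u` turns `bracketForm br X X` into a sum of conjugates
of `X` by `ad(u)` and `ad(u)*`. -/
theorem isPositive_bracketForm {X : V →L[ℝ] V} (hX : X.IsPositive) :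
    (bracketForm br X X).IsPositive := by
  obtain ⟨m, u, hu⟩ := exists_sum_apply_left_eq_of_isPositive hX
  have h := hu (stdOrthonormalBasis ℝ V) (LinearMap.mk₂ ℝ (fun x y : V ↦
      (1 / 2 : ℝ) • (star (br x) * X * br y) + (1 / 4 : ℝ) • (br x * X * star (br y)))
    (fun x x' y ↦ by
      rw [map_add, star_add]; simp only [add_mul, smul_add]; abel)
    (fun c x y ↦ by
      rw [map_smul, star_smul, star_trivial c]
      simp only [smul_mul_assoc, smul_add, smul_comm c])
    (fun x y y' ↦ by
      rw [map_add, star_add]; simp only [mul_add, smul_add]; abel)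
    (fun c x y ↦ by
      rw [map_smul, star_smul, star_trivial c]
      simp only [mul_smul_comm, smul_add, smul_comm c]))
  simp only [LinearMap.mk₂_apply] at h
  rw [bracketForm_apply, h]
  refine ContinuousLinearMap.isPositive_sum _ fun j _ ↦ ?_
  refine ((hX.adjoint_conj (br (u j))).smul_of_nonneg (by norm_num : (0 : ℝ) ≤ 1 / 2)).add
    ((hX.conj_adjoint (br (u j))).smul_of_nonneg (by norm_num : (0 : ℝ) ≤ 1 / 4))

theorem IsTwoStepData.star_mul_p (h : IsTwoStepData br J p) (u : V) :
    star (br u) * p = star (br u) := by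
  have := congr(star $(h.p_mul u))
  rwa [star_mul, h.star_p] at this

theorem IsTwoStepData.p_mul_star (h : IsTwoStepData br J p) (u : V) :
    p * star (br u) = 0 := by
  have := congr(star $(h.mul_p u))
  rwa [star_mul, h.star_p, star_zero] at this

/-- The two summands of `bracketForm` are supported on the orthogonal complement of the range of `p`
and on the range of `p`; multiplication by `p` on either side selects the second one. -/
theorem IsTwoStepData.bracketForm_mul_p (h : IsTwoStepData br J p) (X Y : V →L[ℝ] V) :
    bracketForm br X Y * p = ∑ i, (1 / 4 : ℝ) • (br (X (stdOrthonormalBasis ℝ V i)) * Y *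
          star (br (stdOrthonormalBasis ℝ V i))) := by
  rw [bracketForm_apply, Finset.sum_mul]
  refine Finset.sum_congr rfl fun i _ ↦ ?_
  rw [add_mul, smul_mul_assoc, smul_mul_assoc, mul_assoc _ _ p, h.mul_p, mul_assoc _ _ p,
    h.star_mul_p]
  simp

theorem IsTwoStepData.p_mul_bracketForm (h : IsTwoStepData br J p) (X Y : V →L[ℝ] V) :
    p * bracketForm br X Y = ∑ i, (1 / 4 : ℝ) • (br (X (stdOrthonormalBasis ℝ V i)) * Y *
          star (br (stdOrthonormalBasis ℝ V i))) := by
  rw [bracketForm_apply, Finset.mul_sum]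
  refine Finset.sum_congr rfl fun i _ ↦ ?_
  simp only [mul_add, mul_smul_comm, ← mul_assoc, h.p_mul, h.p_mul_star]
  simp

/-- The velocity of the flow is positive and commutes with `J` and `p` at every `H ≥ 1` commuting
with `J` and `p`. -/
theorem IsTwoStepData.flowField_mem (h : IsTwoStepData br J p) {H : V →L[ℝ] V}
    (hH : H - 1 ∈ commutingPositiveCone J p) : flowField br J H ∈ commutingPositiveCone J p := by
  obtain ⟨hu, hE⟩ := isExpandingPair_inverse hH.1
  have hpos := isPositive_bracketForm (br := br) hE.inverse_pos
  have hNp : Commute (bracketForm br (Ring.inverse H) (Ring.inverse H)) p :=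
    (h.bracketForm_mul_p _ _).trans (h.p_mul_bracketForm _ _).symm
  refine ⟨(hpos.add (hpos.adjoint_conj J)).smul_of_nonneg (by norm_num : (0 : ℝ) ≤ 1 / 2), ?_, ?_⟩
  · refine Commute.smul_left ?_ _
    change _ * J = J * _
    rw [h.star_J, add_mul, mul_add, mul_assoc _ J J, h.J_mul_self, ← mul_assoc J, ← mul_assoc J,
      mul_neg J J, h.J_mul_self]
    simp [add_comm]
  · have hJ : Commute (star J) p := by rw [h.star_J]; exact h.J_comm.neg_left
    exact (hNp.add_left ((hJ.mul_left hNp).mul_left h.J_comm)).smul_left _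

theorem exists_lipschitzOnWith_flowField : ∃ c : NNReal,
    LipschitzOnWith c (flowField br J) {H | H - 1 ∈ commutingPositiveCone J p} :=
  exists_lipschitzOnWith_inverse_form (bracketForm br) (star J) J fun _ hH ↦
    ⟨(isExpandingPair_inverse hH.1).1, (isExpandingPair_inverse hH.1).2.norm_le⟩

theorem exists_norm_flowField_le : ∃ C : NNReal,
    ∀ H, H - 1 ∈ commutingPositiveCone J p → ‖flowField br J H‖ ≤ C :=
  exists_norm_inverse_form_le (bracketForm br) (star J) J fun _ hH ↦
    (isExpandingPair_inverse hH.1).2.norm_le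

theorem contDiffOn_flowField : ContDiffOn ℝ ∞ (flowField br J) {H | IsUnit H} :=
  contDiffOn_inverse_form (bracketForm br) (star J) J

/-- The long-time solution of the flow in the operator coordinate `H`, starting at the identity. -/
theorem IsTwoStepData.exists_flow (h : IsTwoStepData br J p) : ∃ H : ℝ → V →L[ℝ] V, H 0 = 1 ∧
    ContDiffOn ℝ ∞ H (Ici 0) ∧ ∀ t, 0 ≤ t →
      H t - 1 ∈ commutingPositiveCone J p ∧ HasDerivAt H (flowField br J (H t)) t := by
  obtain ⟨c, hc⟩ := exists_lipschitzOnWith_flowField (br := br) (J := J) (p := p)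
  obtain ⟨C, hC⟩ := exists_norm_flowField_le (br := br) (J := J) (p := p)
  obtain ⟨H, hH0, hH⟩ := exists_forall_hasDerivAt_of_cone (commutingPositiveCone J p) 1 hc hC
    fun _ hx ↦ h.flowField_mem hx
  exact ⟨H, hH0, contDiffOn_Ici_of_hasDerivAt contDiffOn_flowField
    (fun t ht ↦ (isExpandingPair_inverse (hH t ht).1.1).1) fun t ht ↦ (hH t ht).2, hH⟩

end Nilpotent

/-! ### The Ricci form of a left-invariant metric -/

section LeftInvariantRicci

set_option linter.unusedSectionVars false

variable {V : Type*} [NormedAddCommGroup V] [InnerProductSpace ℝ V] [FiniteDimensional ℝ V]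
  [CompleteSpace V]

/-- For `Y = S⁻¹`, the map `u ↦ Y ad(u)* S`: the adjoint of `ad(u)` for the inner product
`⟪S ·, ·⟫`. -/
noncomputable def coadjointForm (br : V →L[ℝ] V →L[ℝ] V) (S Y : V →L[ℝ] V) :
    V →L[ℝ] V →L[ℝ] V :=
  (LinearMap.mk₂ ℝ (fun u v : V ↦ (Y * star (br u) * S) v)
    (fun u u' v ↦ by rw [map_add, star_add, mul_add, add_mul, add_apply])
    (fun c u v ↦ by
      rw [map_smul, star_smul, star_trivial c, mul_smul_comm, smul_mul_assoc, smul_apply])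
    (fun u v v' ↦ map_add _ v v')
    (fun c u v ↦ map_smul _ c v)).toContinuousBilinearMap

/-- The product `(u, v) ↦ ∇_u v` of left-invariant fields for the Levi-Civita connection of the
left-invariant metric `⟪S ·, ·⟫` (Koszul's formula), where `Y = S⁻¹`. -/
noncomputable def koszulForm (br : V →L[ℝ] V →L[ℝ] V) (S Y : V →L[ℝ] V) : V →L[ℝ] V →L[ℝ] V :=
  (1 / 2 : ℝ) • (br - coadjointForm br S Y - (coadjointForm br S Y).flip)

/-- The curvature `Γ_u Γ_v w - Γ_v Γ_u w - Γ_{[u, v]} w` of a left-invariant connection. -/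
noncomputable def curvatureForm (br Γ : V →L[ℝ] V →L[ℝ] V) : V →ₗ[ℝ] V →ₗ[ℝ] V →ₗ[ℝ] V :=
  LinearMap.mk₂ ℝ (fun u v : V ↦
      ContinuousLinearMap.coeLM ℝ (Γ u * Γ v - Γ v * Γ u - Γ (br u v)))
    (fun u u' v ↦ by
      rw [← map_add]; congr 1; simp only [map_add, add_apply, add_mul, mul_add]; abel)
    (fun c u v ↦ by
      rw [← map_smul]; congr 1
      simp only [map_smul, smul_apply, smul_mul_assoc, mul_smul_comm, smul_sub])
    (fun u v v' ↦ by
      rw [← map_add]; congr 1; simp only [map_add, add_mul, mul_add]; abel)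
    (fun c u v ↦ by
      rw [← map_smul]; congr 1
      simp only [map_smul, smul_mul_assoc, mul_smul_comm, smul_sub])

/-- The Ricci form: `Ric(v, w)` is the trace of `u ↦ R(u, v)w`. -/
noncomputable def ricciForm (br Γ : V →L[ℝ] V →L[ℝ] V) (v w : V) : ℝ :=
  LinearMap.trace ℝ V (((curvatureForm br Γ).flip v).flip w)

variable {br : V →L[ℝ] V →L[ℝ] V} {J p S Y : V →L[ℝ] V}

theorem curvatureForm_apply (Γ : V →L[ℝ] V →L[ℝ] V) (u v w : V) :
    curvatureForm br Γ u v w = Γ u (Γ v w) - Γ v (Γ u w) - Γ (br u v) w := rfl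

theorem coadjointForm_apply (u : V) : coadjointForm br S Y u = Y * star (br u) * S := rfl

theorem koszulForm_apply (u v : V) : koszulForm br S Y u v =
    (1 / 2 : ℝ) • (br u v - coadjointForm br S Y u v - coadjointForm br S Y v u) := rfl

/-- The product `koszulForm` is torsion-free. -/
theorem koszulForm_sub_swap (hskew : ∀ u v, br u v = -br v u) (u v : V) :
    koszulForm br S Y u v - koszulForm br S Y v u = br u v := by
  rw [koszulForm_apply, koszulForm_apply, ← smul_sub, hskew v u]
  rw [show br u v - coadjointForm br S Y u v - coadjointForm br S Y v u -
    (-br u v - coadjointForm br S Y v u - coadjointForm br S Y u v) = (2 : ℝ) • br u v by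
      rw [two_smul]; abel, smul_smul]
  norm_num

/-- The product `koszulForm` is compatible with the inner product `⟪S ·, ·⟫`. -/
theorem koszulForm_metric (hskew : ∀ u v, br u v = -br v u) (hS : star S = S) (hSY : S * Y = 1)
    (u v w : V) :
    inner ℝ (S (koszulForm br S Y u v)) w + inner ℝ (S v) (koszulForm br S Y u w) = 0 := by
  have hSs : ∀ x y, inner ℝ (S x) y = inner ℝ x (S y) := fun x y ↦ by
    rw [← ContinuousLinearMap.adjoint_inner_right, ← ContinuousLinearMap.star_eq_adjoint, hS]
  have hc : ∀ x y z, inner ℝ (S (coadjointForm br S Y x y)) z = inner ℝ (S y) (br x z) := by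
    intro x y z
    have : S (coadjointForm br S Y x y) = star (br x) (S y) := by
      change (S * (Y * star (br x) * S)) y = _
      rw [← mul_assoc, ← mul_assoc, hSY, one_mul]
      rfl
    rw [this, ContinuousLinearMap.star_eq_adjoint, ContinuousLinearMap.adjoint_inner_left]
  have hc' : ∀ x y z, inner ℝ (S z) (coadjointForm br S Y x y) = inner ℝ (S y) (br x z) := by
    intro x y z
    rw [hSs, real_inner_comm, hc]
  rw [koszulForm_apply, koszulForm_apply]
  simp only [map_smul, map_sub, inner_smul_left, inner_smul_right, inner_sub_left,
    inner_sub_right, hc, hc']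
  rw [hskew w v, inner_neg_right, hSs (br u v) w, real_inner_comm (S w)]
  simp
  ring

/-- The Ricci form of a left-invariant metric on a 2-step nilpotent group, in terms of
`ad(v)* ad(w)` and of the operators `u ↦ ad(u)* v`. -/
theorem IsTwoStepData.ricciForm_eq (h : IsTwoStepData br J p) (hS : star S = S) (hSY : S * Y = 1)
    (hYS : Y * S = 1) (v w : V) :
    ricciForm br (koszulForm br S Y) v w =
      -(1 / 2) * opTrace (coadjointForm br S Y v * br w)
      - 1 / 4 * opTrace ((coadjointForm br S Y).flip v * (coadjointForm br S Y).flip w) := by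
  have hY : star Y = Y := by
    calc star Y = star Y * (S * Y) := by rw [hSY, mul_one]
      _ = star (S * Y) * Y := by rw [star_mul, hS, mul_assoc]
      _ = Y := by rw [hSY, star_one, one_mul]
  set s := coadjointForm br S Y with hs
  have hflip : ∀ x y, s.flip x y = s y x := fun _ _ ↦ rfl
  -- The operators `ad(x)`, `ad(x)*` and `u ↦ ad(u)* x` have trace zero: the first two are
  -- nilpotent, the third is skew-adjoint.
  have trA : ∀ x, opTrace (br x) = 0 := fun x ↦ by
    rw [← h.p_mul x, opTrace_mul_comm, h.mul_p, map_zero]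
  have trs : ∀ x, opTrace (s x) = 0 := fun x ↦ by
    rw [hs, coadjointForm_apply, mul_assoc, opTrace_mul_comm, mul_assoc, hSY, mul_one,
      opTrace_star, trA]
  -- `u ↦ ad(u)* x` is skew-adjoint for the inner product `⟪S ·, ·⟫`
  have hj : ∀ x, star (s.flip x) = -(S * s.flip x * Y) := fun x ↦ by
    have key : S * s.flip x = -(star (s.flip x) * S) := by
      ext y
      refine ext_inner_right ℝ fun z ↦ ?_
      have e1 : (S * s.flip x) y = star (br y) (S x) := by
        change (S * (Y * star (br y) * S)) x = _
        rw [← mul_assoc, ← mul_assoc, hSY, one_mul]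
        rfl
      have e2 : inner ℝ ((star (s.flip x) * S) y) z = inner ℝ y (star (br z) (S x)) := by
        change inner ℝ (star (s.flip x) (S y)) z = _
        rw [ContinuousLinearMap.star_eq_adjoint, ContinuousLinearMap.adjoint_inner_left,
          ← ContinuousLinearMap.adjoint_inner_right, ← ContinuousLinearMap.star_eq_adjoint S, hS]
        change inner ℝ y ((S * (Y * star (br z) * S)) x) = _
        rw [← mul_assoc, ← mul_assoc, hSY, one_mul]
        rfl
      rw [e1, neg_apply, inner_neg_left, e2, ContinuousLinearMap.star_eq_adjoint,
        ContinuousLinearMap.adjoint_inner_left, ContinuousLinearMap.star_eq_adjoint,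
        ContinuousLinearMap.adjoint_inner_right, real_inner_comm (S x), h.skew y z,
        inner_neg_right]
    rw [key, neg_mul, mul_assoc, hSY, mul_one, neg_neg]
  have trj : ∀ x, opTrace (s.flip x) = 0 := fun x ↦ by
    have := opTrace_star (s.flip x)
    rw [hj, map_neg, opTrace_mul_comm, ← mul_assoc, hYS, one_mul] at this
    linarith
  have hN : ∀ x, (koszulForm br S Y).flip x = (-(1 / 2 : ℝ)) • (br x + s.flip x + s x) := by
    intro x
    ext y
    change (1 / 2 : ℝ) • (br y x - s y x - s x y) = (-(1 / 2 : ℝ)) • (br x y + s y x + s x y)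
    rw [h.skew y x]
    module
  have hM : koszulForm br S Y v = (1 / 2 : ℝ) • (br v - s v - s.flip v) := rfl
  have trN : ∀ x, opTrace ((koszulForm br S Y).flip x) = 0 := fun x ↦ by
    rw [hN, map_smul, map_add, map_add, trA, trj, trs]
    simp
  -- The trace of `u ↦ R(u, v)w`, with the dependence on `u` moved to the right.
  have hop : ricciForm br (koszulForm br S Y) v w =
      opTrace ((koszulForm br S Y).flip (koszulForm br S Y v w)
        - koszulForm br S Y v * (koszulForm br S Y).flip w
        + (koszulForm br S Y).flip w * br v) := by
    unfold ricciForm opTrace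
    rw [LinearMap.comp_apply]
    congr 1
    ext u
    simp only [LinearMap.flip_apply, curvatureForm_apply]
    rw [h.skew u v, map_neg]
    simp [ContinuousLinearMap.flip_apply]
  have haa : br v * br w = 0 := by
    rw [← h.p_mul w, ← mul_assoc, h.mul_p, zero_mul]
  have hba : br w * br v = 0 := by
    rw [← h.p_mul v, ← mul_assoc, h.mul_p, zero_mul]
  have hss : s v * s w = 0 := by
    rw [hs, coadjointForm_apply, coadjointForm_apply]
    have : Y * star (br v) * S * (Y * star (br w) * S) =
        Y * (star (br v) * (S * Y) * star (br w)) * S := by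
      simp only [mul_assoc]
    rw [this, hSY, mul_one, ← star_mul, hba, star_zero, mul_zero, zero_mul]
  -- transposition with respect to `⟪S ·, ·⟫` preserves traces
  have t1 : ∀ x y, opTrace (s x * s.flip y) = -opTrace (br x * s.flip y) := fun x y ↦ by
    rw [← opTrace_star (br x * s.flip y), star_mul, hj, hs, coadjointForm_apply, ← hs,
      neg_mul, map_neg, neg_neg, opTrace_mul_comm,
      show S * s.flip y * Y * star (br x) = S * (s.flip y * Y * star (br x)) by
        simp only [mul_assoc], opTrace_mul_comm S]
    simp only [mul_assoc]
  have t2 : opTrace (s w * br v) = opTrace (s v * br w) := by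
    rw [← opTrace_star (s v * br w), star_mul, hs, coadjointForm_apply, coadjointForm_apply,
      star_mul, star_mul, star_star, hS, hY, opTrace_mul_comm (star (br w)),
      opTrace_mul_comm _ (br v)]
    calc opTrace (br v * (Y * star (br w) * S)) = opTrace ((br v * Y * star (br w)) * S) := by
          simp only [mul_assoc]
      _ = opTrace (S * (br v * Y * star (br w))) := opTrace_mul_comm _ _
      _ = _ := by simp only [mul_assoc]
  -- Expand the products of the three-term sums; by nilpotency the products of two operators `ad`
  -- and of two operators `ad*` vanish.
  have e1 : opTrace (koszulForm br S Y v * (koszulForm br S Y).flip w) =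
      -(1 / 4) * (opTrace (br v * s.flip w) + opTrace (br v * s w) - opTrace (s v * br w)
        - opTrace (s v * s.flip w) - opTrace (s.flip v * br w) - opTrace (s.flip v * s.flip w)
        - opTrace (s.flip v * s w)) := by
    rw [hN, hM]
    simp only [smul_mul_assoc, mul_smul_comm, map_smul, sub_mul, mul_add, map_add,
      map_sub, haa, hss, map_zero, smul_eq_mul]
    ring
  have e2 : opTrace ((koszulForm br S Y).flip w * br v) =
      -(1 / 2) * (opTrace (s.flip w * br v) + opTrace (s w * br v)) := by
    rw [hN]
    simp only [smul_mul_assoc, map_smul, add_mul, map_add, hba, map_zero, smul_eq_mul]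
    ring
  rw [hop, map_add, map_sub, trN, e1, e2, t1 v w, opTrace_mul_comm (s.flip v) (s w), t1 w v,
    opTrace_mul_comm (s.flip v) (br w), opTrace_mul_comm (s.flip w) (br v), t2,
    opTrace_mul_comm (br v) (s w), t2]
  ring

/-- The operator `S = (1 - p) H + p H⁻¹` describing the metric whose flow coordinate is `H`; here
`X` stands for `H⁻¹`. -/
noncomputable def metricOp (p H X : V →L[ℝ] V) : V →L[ℝ] V := (1 - p) * H + p * X

theorem IsExpandingPair.star_inverse {H X : V →L[ℝ] V} (hE : IsExpandingPair H X) :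
    star X = X := hE.inverse_pos.isSelfAdjoint

theorem IsExpandingPair.star_eq {H X : V →L[ℝ] V} (hE : IsExpandingPair H X) : star H = H := by
  calc star H = star H * (X * H) := by rw [hE.mul_left, mul_one]
    _ = star (X * H) * H := by rw [star_mul, hE.star_inverse, mul_assoc]
    _ = H := by rw [hE.mul_left, star_one, one_mul]

theorem IsExpandingPair.commute_inverse {H X T : V →L[ℝ] V} (hE : IsExpandingPair H X)
    (hT : Commute H T) : Commute X T := by
  have h1 : X * (H * T) * X = X * (T * H) * X := by rw [hT.eq]
  rw [← mul_assoc X, hE.mul_left, one_mul, mul_assoc X, mul_assoc T, hE.mul_right, mul_one] at h1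
  exact h1.symm

/-- The inverse of the metric operator is obtained by exchanging `H` and `H⁻¹`. -/
theorem metricOp_mul (hp : p * p = p) {H X : V →L[ℝ] V} (hHX : H * X = 1) (hXH : X * H = 1)
    (hH : Commute H p) (hX : Commute X p) : metricOp p H X * metricOp p X H = 1 := by
  have h1 : (1 - p) * H * ((1 - p) * X) = 1 - p := by
    rw [mul_assoc, ← mul_assoc H, ((Commute.one_right H).sub_right hH).eq, mul_assoc (1 - p) H,
      hHX, mul_one, sub_mul, mul_sub, mul_sub, hp]
    simp
  have h2 : (1 - p) * H * (p * H) = 0 := by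
    rw [mul_assoc, ← mul_assoc H, hH.eq, mul_assoc p, ← mul_assoc, sub_mul, hp]
    simp
  have h3 : p * X * ((1 - p) * X) = 0 := by
    rw [mul_assoc, ← mul_assoc X, ((Commute.one_right X).sub_right hX).eq, mul_assoc (1 - p),
      ← mul_assoc, mul_sub, hp]
    simp
  have h4 : p * X * (p * H) = p := by
    rw [mul_assoc, ← mul_assoc X, hX.eq, mul_assoc p X, hXH, mul_one, hp]
  rw [metricOp, metricOp, add_mul, mul_add, mul_add, h1, h2, h3, h4]
  simp

theorem star_metricOp (hp : star p = p) {H X : V →L[ℝ] V} (hHs : star H = H) (hXs : star X = X)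
    (hH : Commute H p) (hX : Commute X p) : star (metricOp p H X) = metricOp p H X := by
  rw [metricOp, star_add, star_mul, star_mul, star_sub, star_one, hp, hHs, hXs, hX.eq,
    ((Commute.one_right H).sub_right hH).eq]

theorem IsTwoStepData.mul_metricOp (h : IsTwoStepData br J p) (H X : V →L[ℝ] V)
    (u : V) : br u * metricOp p H X = br u * H := by
  rw [metricOp, mul_add, ← mul_assoc, ← mul_assoc, mul_sub, h.mul_p]
  simp

theorem IsTwoStepData.metricOp_mul_br (h : IsTwoStepData br J p) {H X : V →L[ℝ] V}
    (hH : Commute H p) (hX : Commute X p) (u : V) : metricOp p H X * br u = X * br u := by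
  rw [metricOp, add_mul, mul_assoc (1 - p), ← h.p_mul u, ← mul_assoc H, hH.eq, ← mul_assoc,
    ← mul_assoc, sub_mul, one_mul, h.p_mul_self, sub_self, zero_mul, zero_mul, zero_add, ← hX.eq,
    mul_assoc X, h.p_mul, h.p_mul]

/-- The Ricci form of the metric that is `H` on the range of `1 - p` and `H⁻¹` on the range of `p`.
Since `br u` maps into the range of `p` and vanishes on it, the operators `ad(u)*` for this metric
are `X ad(u)* X`, which makes the Ricci form a congruence of the quadratic expression `bracketForm`
in `H⁻¹`. -/
theorem IsTwoStepData.ricciForm_metricOp (h : IsTwoStepData br J p) {H X : V →L[ℝ] V}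
    (hE : IsExpandingPair H X) (hHp : Commute H p) (v w : V) :
    ricciForm br (koszulForm br (metricOp p H X) (metricOp p X H)) v w =
      -inner ℝ (((1 - p) * bracketForm br X X - p * X * bracketForm br X X * X) v) w := by
  have hXs := hE.star_inverse
  have hHs := hE.star_eq
  have hXp := hE.commute_inverse hHp
  have hs : ∀ u, coadjointForm br (metricOp p H X) (metricOp p X H) u = X * star (br u) * X := by
    intro u
    have e1 : metricOp p X H * star (br u) = X * star (br u) := by
      have := congr(star $(h.mul_metricOp X H u))
      rwa [star_mul, star_mul, star_metricOp h.star_p hXs hHs hXp hHp, hXs] at this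
    have e2 : star (br u) * metricOp p H X = star (br u) * X := by
      have := congr(star $(h.metricOp_mul_br hHp hXp u))
      rwa [star_mul, star_mul, star_metricOp h.star_p hHs hXs hHp hXp, hXs] at this
    rw [coadjointForm_apply, e1, mul_assoc, e2, mul_assoc]
  have inner_X : ∀ x y, inner ℝ (X x) y = inner ℝ x (X y) := fun x y ↦
    hE.inverse_pos.inner_left_eq_inner_right x y
  have inner_br : ∀ u x y, inner ℝ (star (br u) x) y = inner ℝ x (br u y) := fun u x y ↦ by
    rw [ContinuousLinearMap.star_eq_adjoint, ContinuousLinearMap.adjoint_inner_left]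
  have inner_br' : ∀ u x y, inner ℝ (br u x) y = inner ℝ x (star (br u) y) := fun u x y ↦ by
    rw [ContinuousLinearMap.star_eq_adjoint, ContinuousLinearMap.adjoint_inner_right]
  let e := stdOrthonormalBasis ℝ V
  -- the trace of `ad(v)* ad(w)`
  have t1 : opTrace (X * star (br v) * X * br w) =
      ∑ i, inner ℝ (X (br (e i) v)) (br (X (e i)) w) := by
    rw [opTrace_eq_sum e]
    have hl := sum_apply_left_eq_sum_apply_star_right e
      (LinearMap.mk₂ ℝ (fun x y : V ↦ inner ℝ (br x v) (X (br y w)))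
        (fun x x' y ↦ by simp [inner_add_left]) (fun c x y ↦ by simp [inner_smul_left])
        (fun x y y' ↦ by simp [inner_add_right]) (fun c x y ↦ by simp [inner_smul_right])) X
    simp only [LinearMap.mk₂_apply, hXs] at hl
    calc ∑ i, inner ℝ (e i) ((X * star (br v) * X * br w) (e i))
        = ∑ i, inner ℝ (br (X (e i)) v) (X (br (e i) w)) := by
          refine Finset.sum_congr rfl fun i _ ↦ ?_
          change inner ℝ (e i) (X (star (br v) (X (br w (e i))))) = _
          rw [← inner_X, ← inner_br', h.skew v, h.skew w, map_neg, inner_neg_neg]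
      _ = ∑ i, inner ℝ (br (e i) v) (X (br (X (e i)) w)) := hl
      _ = _ := Finset.sum_congr rfl fun i _ ↦ (inner_X _ _).symm
  -- the trace of the product of `u ↦ ad(u)* v` and `u ↦ ad(u)* w`
  have t2 : opTrace ((coadjointForm br (metricOp p H X) (metricOp p X H)).flip v *
      (coadjointForm br (metricOp p H X) (metricOp p X H)).flip w) =
      -∑ i, inner ℝ (X (star (br (e i)) (X v))) (star (br (X (e i))) (X w)) := by
    have hf : ∀ x u, (coadjointForm br (metricOp p H X) (metricOp p X H)).flip x u =
        X (star (br u) (X x)) := fun x u ↦ by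
      rw [ContinuousLinearMap.flip_apply, hs]; rfl
    rw [opTrace_eq_sum e]
    have hl := sum_apply_left_eq_sum_apply_star_right e
      (LinearMap.mk₂ ℝ (fun x y : V ↦ inner ℝ (star (br x) (X v)) (X (star (br y) (X w))))
        (fun x x' y ↦ by simp [inner_add_left]) (fun c x y ↦ by simp [inner_smul_left])
        (fun x y y' ↦ by simp [inner_add_right]) (fun c x y ↦ by simp [inner_smul_right])) X
    simp only [LinearMap.mk₂_apply, hXs] at hl
    calc _ = ∑ i, -inner ℝ (star (br (X (e i))) (X v)) (X (star (br (e i)) (X w))) := by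
          refine Finset.sum_congr rfl fun i _ ↦ ?_
          rw [mul_apply_eq_comp, hf, hf, ← inner_X, ← inner_br', h.skew, inner_neg_left,
            inner_br', real_inner_comm]
      _ = _ := by
        rw [Finset.sum_neg_distrib, hl]
        simp only [inner_X]
  rw [h.ricciForm_eq (star_metricOp h.star_p hHs hXs hHp hXp)
    (metricOp_mul h.p_mul_self hE.mul_right hE.mul_left hHp hXp)
    (metricOp_mul h.p_mul_self hE.mul_left hE.mul_right hXp hHp), hs, t1, t2]
  have e1 : (1 - p) * bracketForm br X X =
      ∑ i, (1 / 2 : ℝ) • (star (br (X (e i))) * X * br (e i)) := by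
    rw [sub_mul, one_mul, h.p_mul_bracketForm, bracketForm_apply, ← Finset.sum_sub_distrib]
    exact Finset.sum_congr rfl fun i _ ↦ by rw [add_sub_cancel_right]
  have e2 : p * X * bracketForm br X X * X =
      ∑ i, (1 / 4 : ℝ) • (X * (br (X (e i)) * X * star (br (e i))) * X) := by
    rw [← hXp.eq, mul_assoc X, h.p_mul_bracketForm, Finset.mul_sum, Finset.sum_mul]
    simp only [mul_smul_comm, smul_mul_assoc]
    rfl
  rw [e1, e2, sub_apply, inner_sub_left]
  simp only [sum_apply, smul_apply, sum_inner, inner_smul_left, ← Finset.mul_sum]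
  have e3 : ∑ i, inner ℝ ((star (br (X (e i))) * X * br (e i)) v) w =
      ∑ i, inner ℝ (X (br (e i) v)) (br (X (e i)) w) :=
    Finset.sum_congr rfl fun i _ ↦ inner_br _ _ _
  have e4 : ∑ i, inner ℝ ((X * (br (X (e i)) * X * star (br (e i))) * X) v) w =
      ∑ i, inner ℝ (X (star (br (e i)) (X v))) (star (br (X (e i))) (X w)) :=
    Finset.sum_congr rfl fun i _ ↦ by
      change inner ℝ (X (br (X (e i)) (X (star (br (e i)) (X v))))) w = _
      rw [inner_X, inner_br']
  rw [e3, e4]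
  simp
  ring

/-- The evolution equation of the metric operator: its velocity is minus the `J`-invariant part of
the Ricci form. -/
theorem IsTwoStepData.hasDerivAt_metricOp (h : IsTwoStepData br J p) {H : ℝ → V →L[ℝ] V} {t : ℝ}
    (hmem : H t - 1 ∈ commutingPositiveCone J p)
    (hH : HasDerivAt H (flowField br J (H t)) t) (v w : V) :
    HasDerivAt (fun τ ↦ inner ℝ (metricOp p (H τ) (Ring.inverse (H τ)) v) w)
      (-((ricciForm br (koszulForm br (metricOp p (H t) (Ring.inverse (H t)))
            (metricOp p (Ring.inverse (H t)) (H t))) v w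
          + ricciForm br (koszulForm br (metricOp p (H t) (Ring.inverse (H t)))
            (metricOp p (Ring.inverse (H t)) (H t))) (J v) (J w)) / 2)) t := by
  obtain ⟨hu, hE⟩ := isExpandingPair_inverse hmem.1
  have hHJ : Commute (H t) J := by
    simpa using hmem.2.1.add_left (Commute.one_left J)
  have hHp : Commute (H t) p := by
    simpa using hmem.2.2.add_left (Commute.one_left p)
  have hXp := hE.commute_inverse hHp
  have hXJ := hE.commute_inverse hHJ
  rw [h.ricciForm_metricOp hE hHp, h.ricciForm_metricOp hE hHp]
  have hinv : HasDerivAt (fun τ ↦ Ring.inverse (H τ))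
      (-(Ring.inverse (H t) * flowField br J (H t) * Ring.inverse (H t))) t := by
    obtain ⟨u, hu⟩ := hu
    have h1 := hasFDerivAt_ringInverse (𝕜 := ℝ) u
    rw [hu] at h1
    have h2 := h1.comp_hasDerivAt t hH
    have h3 : (↑u⁻¹ : V →L[ℝ] V) = Ring.inverse (H t) := by rw [← hu, Ring.inverse_unit]
    rw [h3] at h2
    refine h2.congr_deriv ?_
    simp
  set X := Ring.inverse (H t)
  have hd : HasDerivAt (fun τ ↦ metricOp p (H τ) (Ring.inverse (H τ)))
      ((1 - p) * flowField br J (H t) + p * -(X * flowField br J (H t) * X)) t :=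
    (hH.const_mul (1 - p)).add (hinv.const_mul p)
  have hd2 : HasDerivAt (fun τ ↦ inner ℝ (metricOp p (H τ) (Ring.inverse (H τ)) v) w)
      (inner ℝ (((1 - p) * flowField br J (H t) + p * -(X * flowField br J (H t) * X)) v) w) t := by
    have := (hd.clm_apply (hasDerivAt_const t v)).inner ℝ (hasDerivAt_const t w)
    simpa using this
  convert hd2 using 1
  set N := bracketForm br X X
  have hF : flowField br J (H t) = (1 / 2 : ℝ) • (N + star J * N * J) := rfl
  have hJs : Commute (star J) p := by rw [h.star_J]; exact h.J_comm.neg_left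
  have hJX : Commute (star J) X := by rw [h.star_J]; exact hXJ.symm.neg_left
  -- `J` commutes with `p` and `X`, so averaging over `J` commutes with passing from `N` to the
  -- Ricci operator.
  have key : (1 - p) * flowField br J (H t) + p * -(X * flowField br J (H t) * X) =
      (1 / 2 : ℝ) • (((1 - p) * N - p * X * N * X) +
        star J * ((1 - p) * N - p * X * N * X) * J) := by
    have k1 : (1 - p) * (star J * N * J) = star J * ((1 - p) * N) * J := by
      rw [← mul_assoc, ← mul_assoc, ← ((Commute.one_right (star J)).sub_right hJs).eq]
      simp only [mul_assoc]
    have k2 : p * (X * (star J * N * J) * X) = star J * (p * X * N * X) * J := by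
      calc p * (X * (star J * N * J) * X) = p * ((X * star J) * N * (J * X)) := by
            simp only [mul_assoc]
        _ = (p * star J) * (X * N * X * J) := by rw [← hJX.eq, ← hXJ.eq]; simp only [mul_assoc]
        _ = _ := by rw [← hJs.eq]; simp only [mul_assoc]
    rw [hF, mul_neg]
    simp only [mul_smul_comm, smul_mul_assoc]
    rw [← smul_neg, ← smul_add]
    congr 1
    simp only [mul_add, add_mul]
    rw [k1, k2]
    simp only [mul_sub, sub_mul, mul_assoc]
    abel
  rw [key, smul_apply, add_apply, inner_smul_left, inner_add_left]
  have hJJ : ∀ T : V →L[ℝ] V, inner ℝ ((star J * T * J) v) w = inner ℝ (T (J v)) (J w) := fun T ↦ by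
    change inner ℝ (star J (T (J v))) w = _
    rw [ContinuousLinearMap.star_eq_adjoint, ContinuousLinearMap.adjoint_inner_left]
  rw [hJJ]
  simp
  ring

end LeftInvariantRicci

/-! ### Derivatives along Lie brackets and Lie framings -/

section SecondDerivative

variable {E : Type*} [NormedAddCommGroup E] [NormedSpace ℝ E]
  {M : Type*} [TopologicalSpace M] [ChartedSpace E M] [IsManifold 𝓘(ℝ, E) ∞ M]
  {V : Type*} [NormedAddCommGroup V] [NormedSpace ℝ V]

theorem IsSmoothField.isDifferentiableFieldAt {X : Π x : M, TangentSpace 𝓘(ℝ, E) x}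
    (hX : IsSmoothField X) (x : M) : IsDifferentiableFieldAt X x :=
  (hX x).mdifferentiableAt (by simp)

/-- The derivative of a smooth function along a smooth vector field is smooth. -/
theorem IsSmoothField.contMDiff_mvfderiv {f : M → V} (hf : ContMDiff 𝓘(ℝ, E) 𝓘(ℝ, V) ∞ f)
    {X : Π x : M, TangentSpace 𝓘(ℝ, E) x} (hX : IsSmoothField X) :
    ContMDiff 𝓘(ℝ, E) 𝓘(ℝ, V) ∞ (fun y ↦ mvfderiv 𝓘(ℝ, E) f y (X y)) := by
  have h := (hf.contMDiff_tangentMap (m := ∞) (by simp)).comp hX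
  intro x
  have h2 := (Bundle.contMDiffAt_totalSpace.1 (h x)).2
  refine h2.congr_of_eventuallyEq (Filter.Eventually.of_forall fun y ↦ ?_)
  simp [mvfderiv, tangentMap]
  rfl

theorem IsSmoothField.mlieBracket [CompleteSpace E] {X Y : Π x : M, TangentSpace 𝓘(ℝ, E) x}
    (hX : IsSmoothField X) (hY : IsSmoothField Y) :
    IsSmoothField (mlieBracket 𝓘(ℝ, E) X Y) := by
  intro x
  have : IsManifold 𝓘(ℝ, E) (((⊤ : ℕ∞) : ℕ∞ω) + 1) M := .of_le (n := ∞) (by simp)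
  exact ContMDiffAt.mlieBracket_vectorField (n := (⊤ : ℕ∞)) (m := (⊤ : ℕ∞)) (hX x) (hY x)
    (by simp [minSmoothness_of_isRCLikeNormedField])

variable [CompleteSpace E]

/-- The derivative along a Lie bracket is the commutator of the derivatives. The identity is read
off from the Jacobi identity for `X`, `Y` and `f • Z`, where the field `Z` does not vanish at the
point. -/
theorem mvfderiv_mlieBracket_of_ne_zero {f : M → ℝ} (hf : ContMDiff 𝓘(ℝ, E) 𝓘(ℝ, ℝ) ∞ f)
    {X Y Z : Π x : M, TangentSpace 𝓘(ℝ, E) x} (hX : IsSmoothField X) (hY : IsSmoothField Y)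
    (hZ : IsSmoothField Z) {x : M} (hZx : Z x ≠ 0) :
    mvfderiv 𝓘(ℝ, E) f x (mlieBracket 𝓘(ℝ, E) X Y x) =
      mvfderiv 𝓘(ℝ, E) (fun y ↦ mvfderiv 𝓘(ℝ, E) f y (Y y)) x (X x)
        - mvfderiv 𝓘(ℝ, E) (fun y ↦ mvfderiv 𝓘(ℝ, E) f y (X y)) x (Y x) := by
  have : IsManifold 𝓘(ℝ, E) (minSmoothness ℝ 3) M :=
    .of_le (n := ∞) (by rw [minSmoothness_of_isRCLikeNormedField]; exact ENat.LEInfty.out)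
  have hfd : ∀ y, MDifferentiableAt 𝓘(ℝ, E) 𝓘(ℝ, ℝ) f y :=
    fun y ↦ (hf y).mdifferentiableAt (by simp)
  have hsm : ∀ W : Π x : M, TangentSpace 𝓘(ℝ, E) x, IsSmoothField W →
      mlieBracket 𝓘(ℝ, E) W (f • Z)
        = (fun y ↦ mvfderiv 𝓘(ℝ, E) f y (W y)) • Z + f • mlieBracket 𝓘(ℝ, E) W Z :=
    fun W hW ↦ funext fun y ↦ by
      rw [mlieBracket_smul_right (hfd y) (hZ.isDifferentiableFieldAt y)]; rfl
  have hfZ : IsSmoothField (f • Z) := fun y ↦ ContMDiffAt.smul_section (hf y) (hZ y)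
  -- The second derivative `W (W' f)` appears as the coefficient of `Z` in `[W, [W', f • Z]]`.
  have key : ∀ W W' : Π x : M, TangentSpace 𝓘(ℝ, E) x, IsSmoothField W → IsSmoothField W' →
      mlieBracket 𝓘(ℝ, E) W (mlieBracket 𝓘(ℝ, E) W' (f • Z)) x
        = (mvfderiv 𝓘(ℝ, E) (fun y ↦ mvfderiv 𝓘(ℝ, E) f y (W' y)) x (W x) • Z x
            + mvfderiv 𝓘(ℝ, E) f x (W' x) • mlieBracket 𝓘(ℝ, E) W Z x)
          + (mvfderiv 𝓘(ℝ, E) f x (W x) • mlieBracket 𝓘(ℝ, E) W' Z x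
            + f x • mlieBracket 𝓘(ℝ, E) W (mlieBracket 𝓘(ℝ, E) W' Z) x) := by
    intro W W' hW hW'
    have h1 : ContMDiff 𝓘(ℝ, E) 𝓘(ℝ, ℝ) ∞ (fun y ↦ mvfderiv 𝓘(ℝ, E) f y (W' y)) :=
      hW'.contMDiff_mvfderiv hf
    have hb := hW'.mlieBracket hZ
    rw [hsm W' hW', mlieBracket_add_right
      (((ContMDiffAt.smul_section (h1 x) (hZ x))).mdifferentiableAt (by simp))
      (((ContMDiffAt.smul_section (hf x) (hb x))).mdifferentiableAt (by simp)),
      mlieBracket_smul_right ((h1 x).mdifferentiableAt (by simp)) (hZ.isDifferentiableFieldAt x),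
      mlieBracket_smul_right (hfd x) (hb.isDifferentiableFieldAt x)]
  have h2 : minSmoothness ℝ 2 ≤ ∞ := by
    rw [minSmoothness_of_isRCLikeNormedField]; exact ENat.LEInfty.out
  have hJ := leibniz_identity_mlieBracket_apply ((hX x).of_le h2) ((hY x).of_le h2)
    ((hfZ x).of_le h2)
  have hJZ := leibniz_identity_mlieBracket_apply ((hX x).of_le h2) ((hY x).of_le h2)
    ((hZ x).of_le h2)
  rw [key X Y hX hY, key Y X hY hX, hsm _ (hX.mlieBracket hY), hJZ] at hJ
  have h0 : (mvfderiv 𝓘(ℝ, E) f x (mlieBracket 𝓘(ℝ, E) X Y x)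
      - (mvfderiv 𝓘(ℝ, E) (fun y ↦ mvfderiv 𝓘(ℝ, E) f y (Y y)) x (X x)
        - mvfderiv 𝓘(ℝ, E) (fun y ↦ mvfderiv 𝓘(ℝ, E) f y (X y)) x (Y x))) • Z x = 0 := by
    rw [← sub_eq_zero] at hJ
    rw [← neg_eq_zero, ← hJ]
    simp only [Pi.add_apply, Pi.smul_apply']
    module
  exact sub_eq_zero.1 ((smul_eq_zero.1 h0).resolve_right hZx)

omit [CompleteSpace E] [IsManifold 𝓘(ℝ, E) ∞ M] in
/-- A continuous linear map commutes with differentiation. -/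
theorem mvfderiv_clm_comp {W : Type*} [NormedAddCommGroup W] [NormedSpace ℝ W] (ℓ : V →L[ℝ] W)
    {f : M → V} {x : M} (hf : MDifferentiableAt 𝓘(ℝ, E) 𝓘(ℝ, V) f x)
    (v : TangentSpace 𝓘(ℝ, E) x) :
    mvfderiv 𝓘(ℝ, E) (fun y ↦ ℓ (f y)) x v = ℓ (mvfderiv 𝓘(ℝ, E) f x v) := by
  have h := (ℓ.hasMFDerivAt (x := f x)).comp x hf.hasMFDerivAt
  have h' : mfderiv 𝓘(ℝ, E) 𝓘(ℝ, W) (fun y ↦ ℓ (f y)) x = _ := h.mfderiv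
  simp only [mvfderiv, h']
  rfl

end SecondDerivative

section Framing

variable {E : Type*} [NormedAddCommGroup E] [NormedSpace ℝ E]
  {M : Type*} [TopologicalSpace M] [ChartedSpace E M] [IsManifold 𝓘(ℝ, E) ∞ M]
  {V : Type*} [NormedAddCommGroup V] [NormedSpace ℝ V]

/-- `θ` is a smooth trivialization of the tangent bundle of `M` by `V` in which the Lie brackets of
the constant vector fields are constant, given by the structure map `br`. Smoothness of `θ` is
expressed in the local trivializations of the tangent bundle. -/
structure IsLieFraming (θ : Π x : M, TangentSpace 𝓘(ℝ, E) x ≃L[ℝ] V) (br : V →L[ℝ] V →L[ℝ] V) :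
    Prop where
  contMDiffAt_coord : ∀ x₀ : M, ContMDiffAt 𝓘(ℝ, E) 𝓘(ℝ, E →L[ℝ] V) ∞
    (fun x ↦ (θ x : TangentSpace 𝓘(ℝ, E) x →L[ℝ] V) ∘L
      (trivializationAt E (TangentSpace 𝓘(ℝ, E)) x₀).symmL ℝ x) x₀
  isSmoothField_symm : ∀ u : V, IsSmoothField (fun x : M ↦ (θ x).symm u)
  mlieBracket_symm : ∀ (u v : V) (x : M),
    mlieBracket 𝓘(ℝ, E) (fun y ↦ (θ y).symm u) (fun y ↦ (θ y).symm v) x = (θ x).symm (br u v)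

namespace IsLieFraming

variable {θ : Π x : M, TangentSpace 𝓘(ℝ, E) x ≃L[ℝ] V} {br : V →L[ℝ] V →L[ℝ] V}

/-- A field in the framing, as the operator between trivializations applied to the local
coordinate of the field. -/
theorem apply_eventuallyEq (X : Π x : M, TangentSpace 𝓘(ℝ, E) x) (x₀ : M) :
    (fun x ↦ θ x (X x)) =ᶠ[nhds x₀]
      fun x ↦ ((θ x : TangentSpace 𝓘(ℝ, E) x →L[ℝ] V) ∘L
        (trivializationAt E (TangentSpace 𝓘(ℝ, E)) x₀).symmL ℝ x)
          (trivializationAt E (TangentSpace 𝓘(ℝ, E)) x₀ ⟨x, X x⟩).2 := by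
  filter_upwards [(trivializationAt E (TangentSpace 𝓘(ℝ, E)) x₀).open_baseSet.mem_nhds
    (FiberBundle.mem_baseSet_trivializationAt' x₀)] with x hx
  simp only [ContinuousLinearMap.comp_apply, ContinuousLinearEquiv.coe_coe]
  rw [Bundle.Trivialization.symmL_apply _ hx, Bundle.Trivialization.symm_apply_apply_mk _ hx]

theorem contMDiff_apply (h : IsLieFraming θ br) {X : Π x : M, TangentSpace 𝓘(ℝ, E) x}
    (hX : IsSmoothField X) : ContMDiff 𝓘(ℝ, E) 𝓘(ℝ, V) ∞ (fun x ↦ θ x (X x)) := fun x₀ ↦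
  ((h.contMDiffAt_coord x₀).clm_apply
    (Bundle.contMDiffAt_totalSpace.1 (hX x₀)).2).congr_of_eventuallyEq (apply_eventuallyEq X x₀)

theorem mdifferentiableAt_apply (h : IsLieFraming θ br) {X : Π x : M, TangentSpace 𝓘(ℝ, E) x}
    {x : M} (hX : IsDifferentiableFieldAt X x) :
    MDifferentiableAt 𝓘(ℝ, E) 𝓘(ℝ, V) (fun y ↦ θ y (X y)) x :=
  (((h.contMDiffAt_coord x).mdifferentiableAt (by simp)).clm_apply
    ((mdifferentiableAt_totalSpace ..).1 hX).2).congr_of_eventuallyEq (apply_eventuallyEq X x)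

variable [CompleteSpace E]

/-- The derivative of a vector-valued function along a Lie bracket is the commutator of the
derivatives. -/
theorem mvfderiv_mlieBracket [FiniteDimensional ℝ V] (h : IsLieFraming θ br) {f : M → V}
    (hf : ContMDiff 𝓘(ℝ, E) 𝓘(ℝ, V) ∞ f) {X Y : Π x : M, TangentSpace 𝓘(ℝ, E) x}
    (hX : IsSmoothField X) (hY : IsSmoothField Y) (x : M) :
    mvfderiv 𝓘(ℝ, E) f x (mlieBracket 𝓘(ℝ, E) X Y x) =
      mvfderiv 𝓘(ℝ, E) (fun y ↦ mvfderiv 𝓘(ℝ, E) f y (Y y)) x (X x)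
        - mvfderiv 𝓘(ℝ, E) (fun y ↦ mvfderiv 𝓘(ℝ, E) f y (X y)) x (Y x) := by
  -- A constant field of the framing is nowhere zero, unless the tangent spaces are trivial; so
  -- `mvfderiv_mlieBracket_of_ne_zero` applies to each coordinate of `f`.
  rcases subsingleton_or_nontrivial V with hV | hV
  · exact Subsingleton.elim _ _
  obtain ⟨u, hu⟩ := exists_ne (0 : V)
  have hfd : ∀ y, MDifferentiableAt 𝓘(ℝ, E) 𝓘(ℝ, V) f y :=
    fun y ↦ (hf y).mdifferentiableAt (by simp)
  refine (SeparatingDual.eq_iff_forall_dual_eq (R := ℝ)).2 fun ℓ ↦ ?_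
  have hb := mvfderiv_mlieBracket_of_ne_zero (f := fun y ↦ ℓ (f y))
    (ℓ.contMDiff.comp hf) hX hY (h.isSmoothField_symm u) (x := x) (by simpa using hu)
  have hc : ∀ Z : Π x : M, TangentSpace 𝓘(ℝ, E) x,
      (fun y ↦ mvfderiv 𝓘(ℝ, E) (fun y ↦ ℓ (f y)) y (Z y))
        = fun y ↦ ℓ (mvfderiv 𝓘(ℝ, E) f y (Z y)) :=
    fun Z ↦ funext fun y ↦ mvfderiv_clm_comp ℓ (hfd y) (Z y)
  rw [hc, hc, mvfderiv_clm_comp ℓ (hfd x),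
    mvfderiv_clm_comp ℓ ((hY.contMDiff_mvfderiv hf x).mdifferentiableAt (by simp)),
    mvfderiv_clm_comp ℓ ((hX.contMDiff_mvfderiv hf x).mdifferentiableAt (by simp))] at hb
  rw [map_sub, hb]

variable [FiniteDimensional ℝ E]

/-- The Lie bracket in a Lie framing. Both sides differ by an expression that is tensorial in
`X` and `Y`, so it is enough to compare them on constant fields. -/
theorem apply_mlieBracket (h : IsLieFraming θ br) {X Y : Π x : M, TangentSpace 𝓘(ℝ, E) x} {x : M}
    (hX : IsDifferentiableFieldAt X x) (hY : IsDifferentiableFieldAt Y x) :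
    θ x (mlieBracket 𝓘(ℝ, E) X Y x) =
      mvfderiv 𝓘(ℝ, E) (fun y ↦ θ y (Y y)) x (X x)
        - mvfderiv 𝓘(ℝ, E) (fun y ↦ θ y (X y)) x (Y x) + br (θ x (X x)) (θ x (Y x)) := by
  -- The tensorial expression, whose value on constant fields is `br`.
  let Φ : (Π x : M, TangentSpace 𝓘(ℝ, E) x) → (Π x : M, TangentSpace 𝓘(ℝ, E) x) → V :=
    fun X Y ↦ θ x (mlieBracket 𝓘(ℝ, E) X Y x) - mvfderiv 𝓘(ℝ, E) (fun y ↦ θ y (Y y)) x (X x)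
        + mvfderiv 𝓘(ℝ, E) (fun y ↦ θ y (X y)) x (Y x)
  have hadd : ∀ {X X' : Π x : M, TangentSpace 𝓘(ℝ, E) x}, IsDifferentiableFieldAt X x →
      IsDifferentiableFieldAt X' x → mvfderiv 𝓘(ℝ, E) (fun y ↦ θ y ((X + X') y)) x
        = mvfderiv 𝓘(ℝ, E) (fun y ↦ θ y (X y)) x + mvfderiv 𝓘(ℝ, E) (fun y ↦ θ y (X' y)) x := by
    intro X X' hX hX'
    rw [← mvfderiv_add (h.mdifferentiableAt_apply hX) (h.mdifferentiableAt_apply hX')]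
    congr 1
    funext y
    simp
  have hsmul : ∀ {f : M → ℝ} {X : Π x : M, TangentSpace 𝓘(ℝ, E) x},
      MDifferentiableAt 𝓘(ℝ, E) 𝓘(ℝ, ℝ) f x → IsDifferentiableFieldAt X x →
      mvfderiv 𝓘(ℝ, E) (fun y ↦ θ y ((f • X) y)) x
        = f x • mvfderiv 𝓘(ℝ, E) (fun y ↦ θ y (X y)) x
          + (mvfderiv 𝓘(ℝ, E) f x).smulRight (θ x (X x)) := by
    intro f X hf hX
    rw [← mvfderiv_smul hf (h.mdifferentiableAt_apply hX)]
    congr 1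
    funext y
    simp
  have h1 : ∀ Y : Π x : M, TangentSpace 𝓘(ℝ, E) x, IsDifferentiableFieldAt Y x →
      TensorialAt 𝓘(ℝ, E) E (fun X ↦ Φ X Y) x := fun Y hY ↦
    { smul := fun {f X} hf hX ↦ by
        simp only [Φ]
        rw [hsmul hf hX, mlieBracket_smul_left hf hX]
        simp only [map_add, map_smul, add_apply,
          smul_apply, ContinuousLinearMap.smulRight_apply, Pi.smul_apply', map_neg, neg_smul]
        module
      add := fun {X X'} hX hX' ↦ by
        simp only [Φ]
        rw [hadd hX hX', mlieBracket_add_left hX hX']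
        simp only [map_add, add_apply, Pi.add_apply]
        module }
  have h2 : ∀ X : Π x : M, TangentSpace 𝓘(ℝ, E) x, IsDifferentiableFieldAt X x →
      TensorialAt 𝓘(ℝ, E) E (fun Y ↦ Φ X Y) x := fun X hX ↦
    { smul := fun {f Y} hf hY ↦ by
        simp only [Φ]
        rw [hsmul hf hY, mlieBracket_smul_right hf hY]
        simp only [map_add, map_smul, add_apply,
          smul_apply, ContinuousLinearMap.smulRight_apply, Pi.smul_apply']
        module
      add := fun {Y Y'} hY hY' ↦ by
        simp only [Φ]
        rw [hadd hY hY', mlieBracket_add_right hY hY']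
        simp only [map_add, add_apply, Pi.add_apply]
        module }
  let X' : Π x : M, TangentSpace 𝓘(ℝ, E) x := fun y ↦ (θ y).symm (θ x (X x))
  let Y' : Π x : M, TangentSpace 𝓘(ℝ, E) x := fun y ↦ (θ y).symm (θ x (Y x))
  have hX' : IsDifferentiableFieldAt X' x := (h.isSmoothField_symm _).isDifferentiableFieldAt x
  have hY' : IsDifferentiableFieldAt Y' x := (h.isSmoothField_symm _).isDifferentiableFieldAt x
  have e1 : Φ X Y = Φ X' Y := (h1 Y hY).pointwise hX hX' (by simp [X'])
  have e2 : Φ X' Y = Φ X' Y' := (h2 X' hX').pointwise hY hY' (by simp [Y'])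
  have e3 : Φ X' Y' = br (θ x (X x)) (θ x (Y x)) := by
    simp only [Φ, X', Y', h.mlieBracket_symm, ContinuousLinearEquiv.apply_symm_apply,
      mvfderiv_const]
    simp
  have := e1.trans (e2.trans e3)
  simp only [Φ] at this
  rw [← this]
  abel

end IsLieFraming

end Framing

/-! ### Metrics and connections that are constant in a Lie framing -/

section Bilinear

variable {E : Type*} [NormedAddCommGroup E] [NormedSpace ℝ E]
  {V : Type*} [NormedAddCommGroup V] [NormedSpace ℝ V]

set_option synthInstance.maxHeartbeats 200000 in
/-- The pullback of a bilinear form along a linear map depends smoothly on the linear map. -/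
theorem contDiff_precomp_comp_comp (T : V →L[ℝ] V →L[ℝ] ℝ) :
    ContDiff ℝ ∞ fun A : E →L[ℝ] V ↦ ContinuousLinearMap.precomp ℝ A ∘L T ∘L A :=
  ((ContinuousLinearMap.compL ℝ E V ℝ).flip.contDiff).clm_comp
    (contDiff_const.clm_comp contDiff_id)

/-- The product rule for a bilinear map. -/
theorem mvfderiv_bilinear {M : Type*} [TopologicalSpace M] [ChartedSpace E M]
    {W : Type*} [NormedAddCommGroup W] [NormedSpace ℝ W] (B : V →L[ℝ] V →L[ℝ] W) {f g : M → V}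
    {x : M} (hf : MDifferentiableAt 𝓘(ℝ, E) 𝓘(ℝ, V) f x)
    (hg : MDifferentiableAt 𝓘(ℝ, E) 𝓘(ℝ, V) g x) (v : TangentSpace 𝓘(ℝ, E) x) :
    mvfderiv 𝓘(ℝ, E) (fun y ↦ B (f y) (g y)) x v
      = B (mvfderiv 𝓘(ℝ, E) f x v) (g x) + B (f x) (mvfderiv 𝓘(ℝ, E) g x v) := by
  have hfg : HasMFDerivAt 𝓘(ℝ, E) 𝓘(ℝ, V × V) (fun y ↦ (f y, g y)) x
      ((mvfderiv 𝓘(ℝ, E) f x).prod (mvfderiv 𝓘(ℝ, E) g x)) :=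
    ⟨hf.continuousAt.prodMk hg.continuousAt, hf.hasMFDerivAt.2.prodMk hg.hasMFDerivAt.2⟩
  have hB : HasMFDerivAt 𝓘(ℝ, V × V) 𝓘(ℝ, W) (fun q : V × V ↦ B q.1 q.2) (f x, g x)
      (B.isBoundedBilinearMap.deriv (f x, g x)) :=
    (B.isBoundedBilinearMap.hasFDerivAt (f x, g x)).hasMFDerivAt
  have h := hB.comp x hfg
  have h' : mfderiv 𝓘(ℝ, E) 𝓘(ℝ, W) (fun y ↦ B (f y) (g y)) x = _ := h.mfderiv
  simp only [mvfderiv, h']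
  exact add_comm _ _

end Bilinear

section FramedMetric

set_option linter.unusedSectionVars false

variable {E : Type*} [NormedAddCommGroup E] [NormedSpace ℝ E] [FiniteDimensional ℝ E]
  [CompleteSpace E]
  {M : Type*} [TopologicalSpace M] [ChartedSpace E M] [IsManifold 𝓘(ℝ, E) ∞ M]
  {V : Type*} [NormedAddCommGroup V] [InnerProductSpace ℝ V] [FiniteDimensional ℝ V]
  [CompleteSpace V]

omit [CompleteSpace V] in
/-- The unit ball of a positive definite form on a finite-dimensional space is bounded. -/
theorem isBounded_setOf_inner_lt_one {S : V →L[ℝ] V} (hS : ∀ v, v ≠ 0 → 0 < inner ℝ (S v) v) :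
    Bornology.IsBounded {v : V | inner ℝ (S v) v < 1} := by
  rcases subsingleton_or_nontrivial V with hV | hV
  · exact (Set.toFinite _).isBounded
  -- The form is bounded below by `c ‖v‖ ^ 2`, where `c` is its minimum on the unit sphere.
  obtain ⟨u, hu, hmin⟩ := (isCompact_sphere (0 : V) 1).exists_isMinOn
    (NormedSpace.sphere_nonempty.2 zero_le_one)
    (f := fun v : V ↦ inner ℝ (S v) v) (by fun_prop)
  have hu0 : u ≠ 0 := by rintro rfl; simp at hu
  have hc := hS u hu0
  set c := inner ℝ (S u) u with hcdef
  refine isBounded_iff_forall_norm_le.2 ⟨1 / c + 1, fun v hv ↦ ?_⟩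
  by_contra! hlt
  have hc' : 0 < 1 / c := by positivity
  have hv1 : 1 ≤ ‖v‖ := by linarith
  have hv0 : 0 < ‖v‖ := by linarith
  have h1 := hmin (show ‖v‖⁻¹ • v ∈ Metric.sphere (0 : V) 1 by
    simp [norm_smul, hv0.ne'])
  simp only [mem_ofPred_eq, map_smul, inner_smul_left, inner_smul_right] at h1 hv
  have h2 : c * ‖v‖ ^ 2 ≤ inner ℝ (S v) v := by
    rw [← hcdef] at h1
    simp only [conj_trivial] at h1
    have := mul_le_mul_of_nonneg_right h1 (sq_nonneg ‖v‖)
    field_simp at this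
    linarith
  have h3 : 1 < c * ‖v‖ := by
    have : 1 / c < ‖v‖ := by linarith
    rwa [div_lt_iff₀ hc, mul_comm] at this
  nlinarith

/-- In a frame `θ`, the Riemannian metric `⟪S θ v, θ w⟫` for a positive definite symmetric
operator `S`. -/
noncomputable def IsLieFraming.metric {θ : Π x : M, TangentSpace 𝓘(ℝ, E) x ≃L[ℝ] V}
    {br : V →L[ℝ] V →L[ℝ] V} (h : IsLieFraming θ br) (S : V →L[ℝ] V) (hS : star S = S)
    (hpos : ∀ v, v ≠ 0 → 0 < inner ℝ (S v) v) : Metric E M where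
  inner x := ContinuousLinearMap.precomp ℝ (θ x : TangentSpace 𝓘(ℝ, E) x →L[ℝ] V) ∘L
    innerSL ℝ ∘L S ∘L (θ x : TangentSpace 𝓘(ℝ, E) x →L[ℝ] V)
  symm x v w := by
    change inner ℝ (S (θ x v)) (θ x w) = inner ℝ (S (θ x w)) (θ x v)
    rw [← ContinuousLinearMap.adjoint_inner_right, ← ContinuousLinearMap.star_eq_adjoint, hS,
      real_inner_comm]
  pos x v hv := hpos (θ x v) (by simpa using hv)
  isVonNBounded x := by
    have h1 := (NormedSpace.isVonNBounded_iff (𝕜 := ℝ) (E := V)).2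
      (isBounded_setOf_inner_lt_one hpos)
    refine (h1.image ((θ x).symm : V →L[ℝ] TangentSpace 𝓘(ℝ, E) x)).subset fun v hv ↦ ?_
    exact ⟨θ x v, hv, by simp⟩
  contMDiff := by
    intro x₀
    refine (contMDiffAt_hom_bundle _).2 ⟨contMDiffAt_id, ?_⟩
    let B : (E →L[ℝ] V) → (E →L[ℝ] E →L[ℝ] ℝ) := fun A ↦
      ContinuousLinearMap.precomp ℝ A ∘L innerSL ℝ ∘L S ∘L A
    have hB : ContDiff ℝ ∞ B := contDiff_precomp_comp_comp (innerSL ℝ ∘L S)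
    refine ((hB.contMDiff.contMDiffAt).comp x₀ (h.contMDiffAt_coord x₀)).congr_of_eventuallyEq ?_
    filter_upwards [(trivializationAt E (TangentSpace 𝓘(ℝ, E)) x₀).open_baseSet.mem_nhds
      (FiberBundle.mem_baseSet_trivializationAt' x₀)] with x hx
    ext v w
    rw [inCoordinates_apply_eq₂ hx hx (Set.mem_univ _)]
    simp only [B, Function.comp_apply, ContinuousLinearMap.precomp_apply,
      ContinuousLinearMap.comp_apply, ContinuousLinearEquiv.coe_coe,
      Bundle.Trivialization.symmL_apply _ hx]
    simp

theorem IsLieFraming.metric_inner {θ : Π x : M, TangentSpace 𝓘(ℝ, E) x ≃L[ℝ] V}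
    {br : V →L[ℝ] V →L[ℝ] V} (h : IsLieFraming θ br) (S : V →L[ℝ] V) (hS : star S = S)
    (hpos : ∀ v, v ≠ 0 → 0 < inner ℝ (S v) v) (x : M) (v w : TangentSpace 𝓘(ℝ, E) x) :
    (h.metric S hS hpos).inner x v w = inner ℝ (S (θ x v)) (θ x w) := rfl

end FramedMetric

section FramedConnection

set_option linter.unusedSectionVars false

variable {E : Type*} [NormedAddCommGroup E] [NormedSpace ℝ E] [FiniteDimensional ℝ E]
  [CompleteSpace E]
  {M : Type*} [TopologicalSpace M] [ChartedSpace E M] [IsManifold 𝓘(ℝ, E) ∞ M]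
  {V : Type*} [NormedAddCommGroup V] [NormedSpace ℝ V]
  {θ : Π x : M, TangentSpace 𝓘(ℝ, E) x ≃L[ℝ] V} {br : V →L[ℝ] V →L[ℝ] V}

/-- In a frame `θ`, the connection whose values on constant fields are given by the product `Γ`. -/
noncomputable def IsLieFraming.connection (h : IsLieFraming θ br) (Γ : V →L[ℝ] V →L[ℝ] V) :
    Connection E M where
  toFun W x := ((θ x).symm : V →L[ℝ] TangentSpace 𝓘(ℝ, E) x) ∘L
    (mvfderiv 𝓘(ℝ, E) (fun y ↦ θ y (W y)) x
      + Γ.flip (θ x (W x)) ∘L (θ x : TangentSpace 𝓘(ℝ, E) x →L[ℝ] V))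
  isCovariantDerivativeOnUniv :=
    { add := fun {W W' x} hW hW' _ ↦ by
        ext v
        apply (θ x).injective
        have := mvfderiv_add (h.mdifferentiableAt_apply hW) (h.mdifferentiableAt_apply hW')
        have e : (fun y ↦ θ y ((W + W') y)) = (fun y ↦ θ y (W y)) + fun y ↦ θ y (W' y) := by
          funext y; simp
        rw [e, this]
        simp
        abel
      leibniz := fun {W f x} hW hf _ ↦ by
        ext v
        apply (θ x).injective
        have := mvfderiv_smul hf (h.mdifferentiableAt_apply hW)
        have e : (fun y ↦ θ y ((f • W) y)) = f • fun y ↦ θ y (W y) := by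
          funext y; simp
        rw [e, this]
        simp
        module }

theorem IsLieFraming.apply_connection (h : IsLieFraming θ br) (Γ : V →L[ℝ] V →L[ℝ] V)
    (W : Π x : M, TangentSpace 𝓘(ℝ, E) x) (x : M) (v : TangentSpace 𝓘(ℝ, E) x) :
    θ x (h.connection Γ W x v)
      = mvfderiv 𝓘(ℝ, E) (fun y ↦ θ y (W y)) x v + Γ (θ x v) (θ x (W x)) := by
  simp [connection]

theorem IsLieFraming.torsion_connection (h : IsLieFraming θ br) {Γ : V →L[ℝ] V →L[ℝ] V}
    (hΓ : ∀ u v, Γ u v - Γ v u = br u v) : (h.connection Γ).torsion = 0 := by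
  refine (CovariantDerivative.torsion_eq_zero_iff _).2 fun {X Y x} hX hY ↦ (θ x).injective ?_
  rw [map_sub, h.apply_connection, h.apply_connection, h.apply_mlieBracket hX hY, ← hΓ]
  abel

/-- The curvature of the connection given by `Γ` on a Lie framing. The second derivatives that
occur in it cancel against the derivative along the Lie bracket. -/
theorem IsLieFraming.apply_curvature [FiniteDimensional ℝ V] (h : IsLieFraming θ br)
    (Γ : V →L[ℝ] V →L[ℝ] V)
    {X Y Z : Π x : M, TangentSpace 𝓘(ℝ, E) x} (hX : IsSmoothField X) (hY : IsSmoothField Y)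
    (hZ : IsSmoothField Z) (x : M) :
    θ x (curvature (h.connection Γ) X Y Z x) =
      Γ (θ x (X x)) (Γ (θ x (Y x)) (θ x (Z x))) - Γ (θ x (Y x)) (Γ (θ x (X x)) (θ x (Z x)))
        - Γ (br (θ x (X x)) (θ x (Y x))) (θ x (Z x)) := by
  have hf := h.contMDiff_apply hZ
  have hfd := (hf x).mdifferentiableAt (by simp)
  have hder : ∀ {W : Π x : M, TangentSpace 𝓘(ℝ, E) x}, IsSmoothField W →
      ∀ v : TangentSpace 𝓘(ℝ, E) x,
      mvfderiv 𝓘(ℝ, E) (fun y ↦ θ y (h.connection Γ Z y (W y))) x v =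
        mvfderiv 𝓘(ℝ, E) (fun y ↦ mvfderiv 𝓘(ℝ, E) (fun y ↦ θ y (Z y)) y (W y)) x v
        + (Γ (mvfderiv 𝓘(ℝ, E) (fun y ↦ θ y (W y)) x v) (θ x (Z x))
          + Γ (θ x (W x)) (mvfderiv 𝓘(ℝ, E) (fun y ↦ θ y (Z y)) x v)) := by
    intro W hW v
    have hWd := (h.contMDiff_apply hW x).mdifferentiableAt (by simp)
    have hd := (hW.contMDiff_mvfderiv hf x).mdifferentiableAt (by simp)
    have hB : MDifferentiableAt 𝓘(ℝ, E) 𝓘(ℝ, V) (fun y ↦ Γ (θ y (W y)) (θ y (Z y))) x :=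
      ((Γ.contMDiff.mdifferentiable (n := ∞) (by simp)).mdifferentiableAt.comp x hWd).clm_apply hfd
    simp only [h.apply_connection]
    rw [mvfderiv_fun_add hd hB, add_apply, mvfderiv_bilinear Γ hWd hfd]
  rw [curvature, map_sub, map_sub, h.apply_connection, h.apply_connection, h.apply_connection,
    hder hX, hder hY, h.apply_connection, h.apply_connection, h.mvfderiv_mlieBracket hf hX hY x,
    h.apply_mlieBracket (hX.isDifferentiableFieldAt x) (hY.isDifferentiableFieldAt x)]
  simp only [map_add, map_sub, add_apply, sub_apply]
  abel

end FramedConnection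

section FramedRicci

variable {E : Type*} [NormedAddCommGroup E] [NormedSpace ℝ E] [FiniteDimensional ℝ E]
  [CompleteSpace E]
  {M : Type*} [TopologicalSpace M] [ChartedSpace E M] [IsManifold 𝓘(ℝ, E) ∞ M]
  {V : Type*} [NormedAddCommGroup V] [InnerProductSpace ℝ V] [FiniteDimensional ℝ V]
  [CompleteSpace V]
  {θ : Π x : M, TangentSpace 𝓘(ℝ, E) x ≃L[ℝ] V} {br : V →L[ℝ] V →L[ℝ] V}

theorem IsLieFraming.isLeviCivita (h : IsLieFraming θ br) (hskew : ∀ u v, br u v = -br v u)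
    {S Y : V →L[ℝ] V} (hS : star S = S) (hpos : ∀ v, v ≠ 0 → 0 < inner ℝ (S v) v)
    (hSY : S * Y = 1) :
    IsLeviCivita (h.metric S hS hpos) (h.connection (koszulForm br S Y)) where
  torsion_free := h.torsion_connection (koszulForm_sub_swap hskew)
  metric W Z x hW hZ v := by
    have := mvfderiv_bilinear (innerSL ℝ ∘L S) (h.mdifferentiableAt_apply hW)
      (h.mdifferentiableAt_apply hZ) v
    have e : ∀ a b : V, (innerSL ℝ ∘L S) a b = inner ℝ (S a) b := fun _ _ ↦ rfl
    refine this.trans ?_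
    rw [h.metric_inner, h.metric_inner, h.apply_connection, h.apply_connection, map_add,
      inner_add_left, inner_add_right]
    have hk := koszulForm_metric hskew hS hSY (θ x v) (θ x (W x)) (θ x (Z x))
    rw [e, e]
    linarith

/-- The Ricci tensor of a metric that is constant in a Lie framing. -/
theorem IsLieFraming.exists_isRicciTensor (h : IsLieFraming θ br)
    (hskew : ∀ u v, br u v = -br v u)
    {S Y : V →L[ℝ] V} (hS : star S = S) (hpos : ∀ v, v ≠ 0 → 0 < inner ℝ (S v) v)
    (hSY : S * Y = 1) :
    ∃ Ric : Π x : M, TangentSpace 𝓘(ℝ, E) x →ₗ[ℝ] TangentSpace 𝓘(ℝ, E) x →ₗ[ℝ] ℝ,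
      IsRicciTensor (h.metric S hS hpos) Ric ∧
      ∀ (x : M) (v w : TangentSpace 𝓘(ℝ, E) x),
        Ric x v w = ricciForm br (koszulForm br S Y) (θ x v) (θ x w) := by
  let Γ := koszulForm br S Y
  -- The curvature and Ricci tensors, transported from `V` by the framing.
  let R : Π x : M, TangentSpace 𝓘(ℝ, E) x →ₗ[ℝ] TangentSpace 𝓘(ℝ, E) x →ₗ[ℝ]
      TangentSpace 𝓘(ℝ, E) x →ₗ[ℝ] TangentSpace 𝓘(ℝ, E) x := fun x ↦
    ((curvatureForm br Γ).compl₁₂ (θ x).toLinearEquiv.toLinearMap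
      (θ x).toLinearEquiv.toLinearMap).compr₂
      (θ x).toLinearEquiv.symm.conj.toLinearMap
  have hR : ∀ (x : M) (u v w : TangentSpace 𝓘(ℝ, E) x),
      R x u v w = (θ x).symm (curvatureForm br Γ (θ x u) (θ x v) (θ x w)) := fun x u v w ↦ rfl
  let Ric : Π x : M, TangentSpace 𝓘(ℝ, E) x →ₗ[ℝ] TangentSpace 𝓘(ℝ, E) x →ₗ[ℝ] ℝ := fun x ↦
    (LinearMap.lflip.comp (R x).flip).compr₂ (LinearMap.trace ℝ _)
  refine ⟨Ric, ⟨h.connection Γ, R, h.isLeviCivita hskew hS hpos hSY, ?_, fun x v w ↦ rfl⟩, ?_⟩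
  · intro X Y Z hX hY hZ x
    apply (θ x).injective
    rw [h.apply_curvature Γ hX hY hZ, hR, ContinuousLinearEquiv.apply_symm_apply,
      curvatureForm_apply]
  · intro x v w
    have e : ((R x).flip v).flip w = (θ x).toLinearEquiv.symm.conj
        (((curvatureForm br Γ).flip (θ x v)).flip (θ x w)) := by
      ext u
      rfl
    change LinearMap.trace ℝ _ (((R x).flip v).flip w) = _
    rw [e, LinearMap.trace_conj', ricciForm]

end FramedRicci

/-! ### The left framing of a Lie group -/

section LeftFraming

variable {E : Type*} [NormedAddCommGroup E] [NormedSpace ℝ E]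
  {G : Type*} [TopologicalSpace G] [ChartedSpace E G] [Group G] [LieGroup 𝓘(ℝ, E) ∞ G]

/-- The differential of the left translation by `a` at `x`, as an operator of the model space to
which all tangent spaces are definitionally equal. -/
noncomputable def leftDeriv (a x : G) : E →L[ℝ] E :=
  mfderiv 𝓘(ℝ, E) 𝓘(ℝ, E) (fun y : G ↦ a * y) x

theorem leftDeriv_mul (a b x : G) :
    leftDeriv (E := E) (a * b) x = leftDeriv a (b * x) ∘L leftDeriv b x := by
  have h : ∀ a x : G, MDifferentiableAt 𝓘(ℝ, E) 𝓘(ℝ, E) (fun y : G ↦ a * y) x := fun a x ↦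
    (contMDiff_mul_left (I := 𝓘(ℝ, E)) (n := ∞)).contMDiffAt.mdifferentiableAt (by simp)
  have e : (fun y : G ↦ a * b * y) = (fun y ↦ a * y) ∘ fun y ↦ b * y := by
    funext y; simp [mul_assoc]
  rw [leftDeriv, e]
  exact mfderiv_comp x (h a (b * x)) (h b x)

omit [LieGroup 𝓘(ℝ, E) ∞ G] in
theorem leftDeriv_one (x : G) : leftDeriv (E := E) 1 x = ContinuousLinearMap.id ℝ E := by
  have h := (hasMFDerivAt_id (I := 𝓘(ℝ, E)) x).congr_of_eventuallyEq
    (f₁ := fun y : G ↦ 1 * y) (Filter.Eventually.of_forall fun y ↦ one_mul y)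
  exact h.mfderiv

variable {V : Type*} [NormedAddCommGroup V] [NormedSpace ℝ V]

/-- The trivialization of the tangent bundle of a Lie group by left translations, followed by an
identification `φ` of the tangent space at the identity with `V`. -/
noncomputable def leftFraming (φ : E ≃L[ℝ] V) (x : G) : TangentSpace 𝓘(ℝ, E) x ≃L[ℝ] V :=
  ContinuousLinearEquiv.equivOfInverse
    (M₁ := E) ((φ : E →L[ℝ] V) ∘L leftDeriv x⁻¹ x) (leftDeriv x 1 ∘L (φ.symm : V →L[ℝ] E))
    (fun v ↦ by
      have h := leftDeriv_mul (E := E) x x⁻¹ x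
      rw [mul_inv_cancel, leftDeriv_one, inv_mul_cancel] at h
      change leftDeriv x 1 (φ.symm (φ (leftDeriv x⁻¹ x v))) = v
      rw [φ.symm_apply_apply]
      exact (congrArg (fun A : E →L[ℝ] E ↦ A v) h).symm)
    (fun u ↦ by
      have h := leftDeriv_mul (E := E) x⁻¹ x 1
      rw [inv_mul_cancel, leftDeriv_one, mul_one] at h
      change φ (leftDeriv x⁻¹ x (leftDeriv x 1 (φ.symm u))) = u
      exact (congrArg φ (congrArg (fun A : E →L[ℝ] E ↦ A (φ.symm u)) h).symm).trans
        (φ.apply_symm_apply u))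

theorem leftFraming_apply (φ : E ≃L[ℝ] V) (x : G) (v : TangentSpace 𝓘(ℝ, E) x) :
    leftFraming φ x v = φ (leftDeriv x⁻¹ x v) := rfl

theorem leftFraming_symm_apply (φ : E ≃L[ℝ] V) (x : G) (u : V) :
    (leftFraming φ x).symm u = mulInvariantVectorField (φ.symm u) x := rfl

/-- Left translations preserve the left framing. -/
theorem leftFraming_mul (φ : E ≃L[ℝ] V) (a x : G) (v : TangentSpace 𝓘(ℝ, E) x) :
    leftFraming φ (a * x) (mfderiv 𝓘(ℝ, E) 𝓘(ℝ, E) (fun y : G ↦ a * y) x v)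
      = leftFraming φ x v := by
  rw [leftFraming_apply, leftFraming_apply]
  have h := leftDeriv_mul (E := E) (a * x)⁻¹ a x
  have e : (a * x)⁻¹ * a = x⁻¹ := by group
  rw [e] at h
  rw [h]
  rfl

/-- The left framing at `x` is the partial derivative of `(x, y) ↦ x⁻¹ * y` in `y` at `y = x`, which
depends smoothly on `x`. Its values lie in the single tangent space at `1`. -/
theorem contMDiffAt_leftFraming (φ : E ≃L[ℝ] V) (x₀ : G) :
    ContMDiffAt 𝓘(ℝ, E) 𝓘(ℝ, E →L[ℝ] V) ∞
    (fun x : G ↦ (leftFraming φ x : TangentSpace 𝓘(ℝ, E) x →L[ℝ] V) ∘L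
      (trivializationAt E (TangentSpace 𝓘(ℝ, E)) x₀).symmL ℝ x) x₀ := by
  have h1 : ContMDiffAt (𝓘(ℝ, E).prod 𝓘(ℝ, E)) 𝓘(ℝ, E) ∞
      (Function.uncurry fun x y : G ↦ x⁻¹ * y) (x₀, id x₀) :=
    (contMDiffAt_fst.inv).mul contMDiffAt_snd
  have h2 := ContMDiffAt.mfderiv (m := ∞) (fun x y : G ↦ x⁻¹ * y) id h1 contMDiffAt_id (by simp)
  -- The local trivialization at `1` need not identify the tangent space at `1` with `E` by the
  -- identity; `K` accounts for the difference.
  let K : E ≃L[ℝ] E := (trivializationAt E (TangentSpace 𝓘(ℝ, E)) (1 : G)).continuousLinearEquivAt ℝ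
    1 (FiberBundle.mem_baseSet_trivializationAt' 1)
  -- The base points `x⁻¹ * x` are equal to `1`, but not definitionally; hence the variables
  -- `c` and `c₀`.
  have hK : ∀ (x c c₀ : G), c = 1 → c₀ = 1 → ∀ D : E →L[ℝ] E,
      ContinuousLinearMap.inCoordinates E (TangentSpace 𝓘(ℝ, E)) E (TangentSpace 𝓘(ℝ, E))
        (σ := RingHom.id ℝ) x₀ x c₀ c D
      = (K : E →L[ℝ] E) ∘L D ∘L (trivializationAt E (TangentSpace 𝓘(ℝ, E)) x₀).symmL ℝ x := by
    rintro x c c₀ rfl rfl D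
    ext v
    refine Eq.trans ?_ (congrFun (Bundle.Trivialization.coe_continuousLinearEquivAt_eq (R := ℝ)
      (trivializationAt E (TangentSpace 𝓘(ℝ, E)) (1 : G))
      (FiberBundle.mem_baseSet_trivializationAt' 1)) _).symm
    rfl
  have h3 := (contMDiffAt_const (c := (φ : E →L[ℝ] V) ∘L (K.symm : E →L[ℝ] E))).clm_comp h2
  refine h3.congr_of_eventuallyEq (Filter.Eventually.of_forall fun x ↦ ?_)
  ext v
  have := congrArg (fun A : E →L[ℝ] E ↦ φ (K.symm (A v)))
    (hK x (x⁻¹ * x) (x₀⁻¹ * x₀) (by simp) (by simp) (leftDeriv x⁻¹ x))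
  refine Eq.trans ?_ this.symm
  exact congrArg φ (K.symm_apply_apply _).symm

/-- The constant fields of the left framing are smooth, by smoothness of operator inversion. -/
theorem isSmoothField_leftFraming_symm [CompleteSpace E] (φ : E ≃L[ℝ] V) (u : V) :
    IsSmoothField (fun x : G ↦ (leftFraming φ x).symm u) := by
  intro x₀
  refine Bundle.contMDiffAt_totalSpace.2 ⟨contMDiffAt_id, ?_⟩
  let e := trivializationAt E (TangentSpace 𝓘(ℝ, E)) x₀
  let A : ∀ x, x ∈ e.baseSet → E ≃L[ℝ] V := fun x hx ↦
    (e.continuousLinearEquivAt ℝ x hx).symm.trans (leftFraming φ x)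
  have hA : ∀ x (hx : x ∈ e.baseSet),
      (leftFraming φ x : TangentSpace 𝓘(ℝ, E) x →L[ℝ] V) ∘L e.symmL ℝ x = A x hx := fun x hx ↦ by
    rw [← Bundle.Trivialization.symm_continuousLinearEquivAt_eq' e hx]
    rfl
  have hx₀ : x₀ ∈ e.baseSet := FiberBundle.mem_baseSet_trivializationAt' x₀
  have h1 := contMDiffAt_leftFraming φ x₀
  have h2 : ContMDiffAt 𝓘(ℝ, E →L[ℝ] V) 𝓘(ℝ, V →L[ℝ] E) ∞ ContinuousLinearMap.inverse
      ((leftFraming φ x₀ : TangentSpace 𝓘(ℝ, E) x₀ →L[ℝ] V) ∘L e.symmL ℝ x₀) := by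
    rw [hA x₀ hx₀]
    exact (contDiffAt_map_inverse (A x₀ hx₀)).contMDiffAt
  refine ((h2.comp x₀ h1).clm_apply (contMDiffAt_const (c := u))).congr_of_eventuallyEq ?_
  filter_upwards [e.open_baseSet.mem_nhds hx₀] with x hx
  have h3 := congrArg (fun B : E →L[ℝ] V ↦ ContinuousLinearMap.inverse B u) (hA x hx)
  refine Eq.trans ?_ h3.symm
  simp only [ContinuousLinearMap.inverse_equiv]
  rfl

/-- The Lie bracket of the Lie algebra of `G`, as a bilinear map on the model space. -/
noncomputable def lieBilinear [CompleteSpace E] : E →ₗ[ℝ] E →ₗ[ℝ] E :=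
  let B : GroupLieAlgebra 𝓘(ℝ, E) G →ₗ[ℝ] GroupLieAlgebra 𝓘(ℝ, E) G →ₗ[ℝ]
      GroupLieAlgebra 𝓘(ℝ, E) G :=
    LinearMap.mk₂ ℝ (fun v w ↦ ⁅v, w⁆) add_lie smul_lie lie_add (fun c v w ↦ lie_smul c v w)
  B

theorem lieBilinear_skew [CompleteSpace E] (v w : E) :
    lieBilinear (E := E) (G := G) v w = -lieBilinear (E := E) (G := G) w v :=
  (lie_skew (L := GroupLieAlgebra 𝓘(ℝ, E) G) v w).symm

variable (E G) in
/-- The commutator ideal of the Lie algebra of `G`, as a subspace of the model space. -/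
noncomputable def derivedSubmodule [CompleteSpace E] : Submodule ℝ E :=
  (⁅(⊤ : LieIdeal ℝ (GroupLieAlgebra 𝓘(ℝ, E) G)),
    (⊤ : LieIdeal ℝ (GroupLieAlgebra 𝓘(ℝ, E) G))⁆ :
      LieIdeal ℝ (GroupLieAlgebra 𝓘(ℝ, E) G)).toSubmodule

theorem lieBilinear_mem [CompleteSpace E] (v w : E) :
    lieBilinear (E := E) (G := G) v w ∈ derivedSubmodule E G := by
  have h : ∀ v' w' : GroupLieAlgebra 𝓘(ℝ, E) G,
      ⁅v', w'⁆ ∈ ⁅(⊤ : LieIdeal ℝ (GroupLieAlgebra 𝓘(ℝ, E) G)),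
        (⊤ : LieIdeal ℝ (GroupLieAlgebra 𝓘(ℝ, E) G))⁆ := fun v' w' ↦
    LieSubmodule.lie_mem_lie (LieSubmodule.mem_top v') (LieSubmodule.mem_top w')
  exact h v w

/-- In a 2-step nilpotent Lie algebra the commutator ideal is central. -/
theorem lieBilinear_eq_zero [CompleteSpace E]
    (hnil : LieModule.lowerCentralSeries ℝ (GroupLieAlgebra 𝓘(ℝ, E) G)
      (GroupLieAlgebra 𝓘(ℝ, E) G) 2 = ⊥) (v : E) {d : E} (hd : d ∈ derivedSubmodule E G) :
    lieBilinear (E := E) (G := G) v d = 0 := by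
  have h : ∀ v' d' : GroupLieAlgebra 𝓘(ℝ, E) G,
      d' ∈ ⁅(⊤ : LieIdeal ℝ (GroupLieAlgebra 𝓘(ℝ, E) G)),
        (⊤ : LieIdeal ℝ (GroupLieAlgebra 𝓘(ℝ, E) G))⁆ → ⁅v', d'⁆ = 0 := by
    intro v' d' hd'
    have h : ⁅v', d'⁆ ∈ LieModule.lowerCentralSeries ℝ
        (GroupLieAlgebra 𝓘(ℝ, E) G) (GroupLieAlgebra 𝓘(ℝ, E) G) 2 := by
      rw [LieModule.lowerCentralSeries_succ, LieModule.lowerCentralSeries_succ,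
        LieModule.lowerCentralSeries_zero]
      exact LieSubmodule.lie_mem_lie (LieSubmodule.mem_top v') hd'
    rwa [hnil] at h
  exact h v d hd

/-- The Lie bracket of the Lie algebra of `G`, transported to `V`. -/
noncomputable def leftBracket [CompleteSpace E] [FiniteDimensional ℝ V] (φ : E ≃L[ℝ] V) :
    V →L[ℝ] V →L[ℝ] V :=
  (((lieBilinear (E := E) (G := G)).compl₁₂ φ.symm.toLinearEquiv.toLinearMap
    φ.symm.toLinearEquiv.toLinearMap).compr₂ φ.toLinearEquiv.toLinearMap).toContinuousBilinearMap

theorem leftBracket_apply [CompleteSpace E] [FiniteDimensional ℝ V] (φ : E ≃L[ℝ] V) (u v : V) :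
    leftBracket (G := G) φ u v = φ (lieBilinear (E := E) (G := G) (φ.symm u) (φ.symm v)) := rfl

theorem isLieFraming_leftFraming [CompleteSpace E] [FiniteDimensional ℝ V] (φ : E ≃L[ℝ] V) :
    IsLieFraming (leftFraming (G := G) φ) (leftBracket (G := G) φ) where
  contMDiffAt_coord := contMDiffAt_leftFraming φ
  isSmoothField_symm := isSmoothField_leftFraming_symm φ
  mlieBracket_symm u v x := by
    have h := congrFun (mulInvariantVector_mlieBracket (I := 𝓘(ℝ, E)) (G := G)
      (φ.symm u) (φ.symm v)) x
    refine h.symm.trans ?_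
    rw [leftFraming_symm_apply]
    refine congrArg (fun w : E ↦ mulInvariantVectorField (I := 𝓘(ℝ, E)) (G := G) w x) ?_
    rw [leftBracket_apply, φ.symm_apply_apply]
    rfl

end LeftFraming

/-- A positive definite symmetric form is the standard inner product in suitable coordinates. -/
theorem exists_linearEquiv_inner_eq {F : Type*} [AddCommGroup F] [Module ℝ F]
    [FiniteDimensional ℝ F] (B : F →ₗ[ℝ] F →ₗ[ℝ] ℝ) (hsymm : ∀ v w, B v w = B w v)
    (hpos : ∀ v, v ≠ 0 → 0 < B v v) :
    ∃ φ : F ≃ₗ[ℝ] EuclideanSpace ℝ (Fin (Module.finrank ℝ F)),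
      ∀ v w, B v w = inner ℝ (φ v) (φ w) := by
  let core : InnerProductSpace.Core ℝ F :=
    { inner := fun v w ↦ B v w
      conj_inner_symm := fun v w ↦ by simpa using hsymm w v
      re_inner_nonneg := fun v ↦ by
        rcases eq_or_ne v 0 with rfl | hv
        · simp
        · simpa using (hpos v hv).le
      add_left := fun u v w ↦ by simp
      smul_left := fun u v c ↦ by simp
      definite := fun v hv ↦ by
        by_contra hne
        exact (hpos v hne).ne' hv }
  let _ : NormedAddCommGroup F := core.toNormedAddCommGroup
  let _ : InnerProductSpace ℝ F := InnerProductSpace.ofCore core.toCore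
  let b := stdOrthonormalBasis ℝ F
  exact ⟨b.repr.toLinearEquiv, fun v w ↦ (b.repr.inner_map_map v w).symm⟩

section TwoStep

variable {E : Type*} [NormedAddCommGroup E] [NormedSpace ℝ E] [FiniteDimensional ℝ E]
  [CompleteSpace E]
  {G : Type*} [TopologicalSpace G] [ChartedSpace E G] [Group G] [LieGroup 𝓘(ℝ, E) ∞ G]
  {V : Type*} [NormedAddCommGroup V] [InnerProductSpace ℝ V] [FiniteDimensional ℝ V]
  [CompleteSpace V]

/-- A skew-adjoint operator preserving a subspace preserves its orthogonal complement, hence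
commutes with the orthogonal projection. -/
theorem starProjection_commute_of_mem {J : V →L[ℝ] V} {Z : Submodule ℝ V} (hJ : star J = -J)
    (hZ : ∀ z ∈ Z, J z ∈ Z) : Commute J Z.starProjection := by
  have hJi : ∀ v w, inner ℝ (J v) w = -inner ℝ v (J w) := fun v w ↦ by
    rw [← ContinuousLinearMap.adjoint_inner_right, ← ContinuousLinearMap.star_eq_adjoint, hJ,
      neg_apply, inner_neg_right]
  have hZo : ∀ w ∈ Zᗮ, J w ∈ Zᗮ := fun w hw ↦ by
    rw [Submodule.mem_orthogonal]
    intro z hz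
    rw [real_inner_comm, hJi, real_inner_comm, (Submodule.mem_orthogonal _ _).1 hw _ (hZ z hz),
      neg_zero]
  ext v
  change J (Z.starProjection v) = Z.starProjection (J v)
  refine (Submodule.eq_starProjection_of_mem_of_inner_eq_zero (hZ _ (by simp)) ?_).symm
  intro w hw
  rw [← map_sub]
  have := hZo (v - Z.starProjection v) (Submodule.sub_starProjection_mem_orthogonal v)
  exact (Submodule.mem_orthogonal' _ _).1 this w hw

/-- The Lie algebra of a 2-step nilpotent group with a compatible complex structure and metric;
`p` is the orthogonal projection onto the commutator ideal. -/
theorem isTwoStepData_leftBracket (φ : E ≃L[ℝ] V)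
    (hnil : LieModule.lowerCentralSeries ℝ (GroupLieAlgebra 𝓘(ℝ, E) G)
      (GroupLieAlgebra 𝓘(ℝ, E) G) 2 = ⊥) {J₁ : E →L[ℝ] E}
    (hJsq : ∀ v, J₁ (J₁ v) = -v)
    (hJinner : ∀ v w, inner ℝ (φ (J₁ v)) (φ (J₁ w)) = inner ℝ (φ v) (φ w))
    (hJcomm : ∀ v ∈ derivedSubmodule E G, J₁ v ∈ derivedSubmodule E G) :
    ∃ p : V →L[ℝ] V, IsTwoStepData (leftBracket (G := G) φ)
      ((φ : E →L[ℝ] V) ∘L J₁ ∘L (φ.symm : V →L[ℝ] E)) p := by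
  let Z : Submodule ℝ V := (derivedSubmodule E G).map φ.toLinearEquiv.toLinearMap
  have hbrZ : ∀ u v : V, leftBracket (G := G) φ u v ∈ Z := fun u v ↦
    Submodule.mem_map_of_mem (lieBilinear_mem (φ.symm u) (φ.symm v))
  have hZbr : ∀ u, ∀ z ∈ Z, leftBracket (G := G) φ u z = 0 := by
    rintro u _ ⟨d, hd, rfl⟩
    rw [leftBracket_apply]
    change φ (lieBilinear (E := E) (G := G) (φ.symm u) (φ.symm (φ d))) = 0
    rw [φ.symm_apply_apply, lieBilinear_eq_zero hnil _ hd, map_zero]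
  have hstar : star ((φ : E →L[ℝ] V) ∘L J₁ ∘L (φ.symm : V →L[ℝ] E))
      = -((φ : E →L[ℝ] V) ∘L J₁ ∘L (φ.symm : V →L[ℝ] E)) := by
    rw [ContinuousLinearMap.star_eq_adjoint]
    refine (ContinuousLinearMap.eq_adjoint_iff _ _).2 (fun v w ↦ ?_) |>.symm
    have := hJinner (J₁ (φ.symm v)) (φ.symm w)
    rw [hJsq] at this
    simp only [map_neg, inner_neg_left] at this
    simp only [neg_apply, inner_neg_left, ContinuousLinearMap.comp_apply,
      ContinuousLinearEquiv.coe_coe]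
    simp only [ContinuousLinearEquiv.apply_symm_apply] at this
    linarith
  refine ⟨Z.starProjection, ⟨fun u v ↦ ?_, isSelfAdjoint_starProjection Z, ?_, fun u ↦ ?_,
    fun u ↦ ?_, hstar, ?_, starProjection_commute_of_mem hstar ?_⟩⟩
  · rw [leftBracket_apply, leftBracket_apply, ← map_neg]
    exact congrArg φ (lieBilinear_skew (φ.symm u) (φ.symm v))
  · exact Z.isIdempotentElem_starProjection
  · ext v
    exact Submodule.starProjection_eq_self_iff.2 (hbrZ u v)
  · ext v
    exact hZbr u _ (by simp)
  · ext v
    simp [hJsq]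
  · rintro _ ⟨d, hd, rfl⟩
    refine ⟨J₁ d, hJcomm d hd, ?_⟩
    simp

end TwoStep

/-! ### The flow on the group -/

section MetricOperator

variable {V : Type*} [NormedAddCommGroup V] [InnerProductSpace ℝ V] [FiniteDimensional ℝ V]
  [CompleteSpace V]

/-- On the range of `1 - p` the form is at least the norm squared, on the range of `p` it is given
by the positive invertible operator `X`. -/
theorem IsExpandingPair.metricOp_pos {p H X : V →L[ℝ] V} (hps : star p = p) (hp : p * p = p)
    (hE : IsExpandingPair H X) (hH1 : (H - 1).IsPositive) (hHp : Commute H p) {v : V}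
    (hv : v ≠ 0) : 0 < inner ℝ (metricOp p H X v) v := by
  have hXp : Commute X p := hE.commute_inverse hHp
  have hpi : ∀ a b, inner ℝ (p a) b = inner ℝ a (p b) := fun a b ↦ by
    rw [← ContinuousLinearMap.adjoint_inner_right, ← ContinuousLinearMap.star_eq_adjoint, hps]
  have hpp : ∀ a, p (p a) = p a := fun a ↦ congr($hp a)
  have hHpa : ∀ a, H (p a) = p (H a) := fun a ↦ congr($(hHp.eq) a)
  have hXpa : ∀ a, X (p a) = p (X a) := fun a ↦ congr($(hXp.eq) a)
  set q := v - p v with hq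
  have e : inner ℝ (metricOp p H X v) v = inner ℝ (H q) q + inner ℝ (X (p v)) (p v) := by
    have : metricOp p H X v = (H v - p (H v)) + p (X v) := rfl
    have h0 : inner ℝ (H v - p (H v)) (p v) = 0 := by
      rw [← hpi, map_sub, hpp, sub_self, inner_zero_left]
    rw [this, hq, map_sub, hHpa, hXpa, inner_add_left, inner_sub_right, h0, sub_zero,
      hpi (X v) v, hpi (X v) (p v), hpp]
  have h1 : ‖q‖ ^ 2 ≤ inner ℝ (H q) q := by
    have := hH1.inner_nonneg_left q
    rw [sub_apply, inner_sub_left] at this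
    rw [← real_inner_self_eq_norm_sq]
    simpa using this
  have h2 : 0 ≤ inner ℝ (X (p v)) (p v) := hE.inverse_pos.inner_nonneg_left _
  have h2' : p v ≠ 0 → 0 < inner ℝ (X (p v)) (p v) := by
    intro hne
    have hXv : X (p v) ≠ 0 := by
      intro h0
      have : H (X (p v)) = p v := congr($(hE.mul_right) (p v))
      rw [h0, map_zero] at this
      exact hne this.symm
    have h3 := hH1.inner_nonneg_left (X (p v))
    have : H (X (p v)) = p v := congr($(hE.mul_right) (p v))
    rw [sub_apply, inner_sub_left, this, real_inner_comm] at h3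
    change 0 ≤ _ - inner ℝ (X (p v)) (X (p v)) at h3
    rw [real_inner_self_eq_norm_sq] at h3
    have := norm_pos_iff.2 hXv
    nlinarith
  rw [e]
  rcases eq_or_ne (p v) 0 with h0 | h0
  · have : q ≠ 0 := by rwa [hq, h0, sub_zero]
    have := norm_pos_iff.2 this
    nlinarith
  · have := h2' h0
    nlinarith [sq_nonneg ‖q‖]

end MetricOperator

/-- An orthonormal frame at a point, as a linear isomorphism with Euclidean space. -/
theorem exists_frame_of_metric {E : Type*} [NormedAddCommGroup E] [NormedSpace ℝ E]
    [FiniteDimensional ℝ E] [CompleteSpace E]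
    {M : Type*} [TopologicalSpace M] [ChartedSpace E M] [IsManifold 𝓘(ℝ, E) ∞ M]
    (g : Metric E M) (x : M) :
    ∃ φ : E ≃L[ℝ] EuclideanSpace ℝ (Fin (Module.finrank ℝ E)),
      ∀ v w : TangentSpace 𝓘(ℝ, E) x, g.inner x v w = inner ℝ (φ v) (φ w) := by
  let B : TangentSpace 𝓘(ℝ, E) x →ₗ[ℝ] TangentSpace 𝓘(ℝ, E) x →ₗ[ℝ] ℝ :=
    LinearMap.mk₂ ℝ (fun v w ↦ g.inner x v w) (by simp) (by simp) (by simp) (by simp)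
  -- The form is moved to the model space `E`, whose topology is the one `φ` refers to.
  have hB : ∀ B : E →ₗ[ℝ] E →ₗ[ℝ] ℝ, (∀ v w, B v w = B w v) → (∀ v, v ≠ 0 → 0 < B v v) →
      ∃ φ : E ≃L[ℝ] EuclideanSpace ℝ (Fin (Module.finrank ℝ E)),
        ∀ v w, B v w = inner ℝ (φ v) (φ w) := fun B hsymm hpos ↦ by
    obtain ⟨φ, hφ⟩ := exists_linearEquiv_inner_eq B hsymm hpos
    exact ⟨φ.toContinuousLinearEquiv, hφ⟩
  exact hB B (g.symm x) (g.pos x)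

/-- The flow, for a metric that the frame `φ` at the identity makes the standard inner product. -/
theorem exists_isLongTimeSolution
    {E : Type*} [NormedAddCommGroup E] [NormedSpace ℝ E] [FiniteDimensional ℝ E] [CompleteSpace E]
    {G : Type*} [TopologicalSpace G] [ChartedSpace E G] [Group G] [LieGroup 𝓘(ℝ, E) ∞ G]
    {V : Type*} [NormedAddCommGroup V] [InnerProductSpace ℝ V] [FiniteDimensional ℝ V]
    [CompleteSpace V]
    (hnil : LieModule.lowerCentralSeries ℝ (GroupLieAlgebra 𝓘(ℝ, E) G)
      (GroupLieAlgebra 𝓘(ℝ, E) G) 2 = ⊥)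
    (J : Π x : G, TangentSpace 𝓘(ℝ, E) x →L[ℝ] TangentSpace 𝓘(ℝ, E) x)
    (hJ : IsComplexStructure J)
    (hJinv : IsLeftInvariantEndo J)
    (hJcomm : ∀ v : GroupLieAlgebra 𝓘(ℝ, E) G,
      v ∈ ⁅(⊤ : LieIdeal ℝ (GroupLieAlgebra 𝓘(ℝ, E) G)),
        (⊤ : LieIdeal ℝ (GroupLieAlgebra 𝓘(ℝ, E) G))⁆ →
      J 1 v ∈ ⁅(⊤ : LieIdeal ℝ (GroupLieAlgebra 𝓘(ℝ, E) G)),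
        (⊤ : LieIdeal ℝ (GroupLieAlgebra 𝓘(ℝ, E) G))⁆)
    (g₀ : Metric E G)
    (hg₀inv : IsLeftInvariantMetric g₀)
    (hg₀herm : IsHermitian J g₀) (φ : E ≃L[ℝ] V)
    (hφ : ∀ v w : TangentSpace 𝓘(ℝ, E) (1 : G), g₀.inner 1 v w = inner ℝ (φ v) (φ w)) :
    ∃ g : ℝ → Metric E G,
      g 0 = g₀ ∧
      (∀ t : ℝ, 0 ≤ t → IsLeftInvariantMetric (g t)) ∧
      IsLongTimeSolution J g := by
  let J₁ : E →L[ℝ] E := J 1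
  -- By left invariance, the complex structure and the metric are constant in the left framing. The
  -- points `x⁻¹ * x` and `1` are not definitionally equal, which is why `c` is generalized.
  have hJφ : ∀ (x : G) (v : TangentSpace 𝓘(ℝ, E) x),
      leftFraming φ x (J x v) = φ (J₁ (leftDeriv (E := E) x⁻¹ x v)) := by
    intro x v
    have h : ∀ c : G, c = 1 → ∀ v : E, (J c : E →L[ℝ] E) v = (J 1 : E →L[ℝ] E) v := by
      rintro c rfl v; rfl
    exact congrArg φ ((hJinv x⁻¹ x v).symm.trans (h _ (inv_mul_cancel x) _))
  have hgφ : ∀ (x : G) (v w : TangentSpace 𝓘(ℝ, E) x),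
      g₀.inner x v w = inner ℝ (leftFraming φ x v) (leftFraming φ x w) := by
    intro x v w
    have h : ∀ c : G, c = 1 → ∀ v w : E, g₀.inner c v w = g₀.inner 1 v w := by
      rintro c rfl v w; rfl
    exact (hg₀inv x⁻¹ x v w).symm.trans ((h _ (inv_mul_cancel x) _ _).trans (hφ _ _))
  obtain ⟨p, hdata⟩ := isTwoStepData_leftBracket (J₁ := J₁) φ hnil (hJ.sq 1)
    (fun v w ↦ by
      exact (hφ _ _).symm.trans ((hg₀herm 1 v w).trans (hφ v w))) hJcomm
  set br := leftBracket (G := G) φ with hbr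
  set JV := (φ : E →L[ℝ] V) ∘L J₁ ∘L (φ.symm : V →L[ℝ] E) with hJV
  have hJθ : ∀ (x : G) (v : TangentSpace 𝓘(ℝ, E) x),
      leftFraming φ x (J x v) = JV (leftFraming φ x v) := fun x v ↦ by
    rw [hJφ]
    change _ = φ (J₁ (φ.symm (φ (leftDeriv x⁻¹ x v))))
    rw [φ.symm_apply_apply]
  have hfr := isLieFraming_leftFraming (G := G) φ
  obtain ⟨H, hH0, hHs, hH⟩ := hdata.exists_flow
  let S : ℝ → V →L[ℝ] V := fun t ↦ metricOp p (H t) (Ring.inverse (H t))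
  have hE : ∀ t, 0 ≤ t → IsUnit (H t) ∧ IsExpandingPair (H t) (Ring.inverse (H t)) :=
    fun t ht ↦ isExpandingPair_inverse (hH t ht).1.1
  have hcomm : ∀ T : V →L[ℝ] V, ∀ t, Commute (H t - 1) T → Commute (H t) T :=
    fun T t h ↦ by simpa using h.add_left (Commute.one_left T)
  have hHp : ∀ t, 0 ≤ t → Commute (H t) p := fun t ht ↦ hcomm p t (hH t ht).1.2.2
  have hHJ : ∀ t, 0 ≤ t → Commute (H t) JV := fun t ht ↦ hcomm JV t (hH t ht).1.2.1
  have hSstar : ∀ t, 0 ≤ t → star (S t) = S t := fun t ht ↦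
    star_metricOp hdata.star_p (hE t ht).2.star_eq (hE t ht).2.star_inverse (hHp t ht)
      ((hE t ht).2.commute_inverse (hHp t ht))
  have hSpos : ∀ t, 0 ≤ t → ∀ v, v ≠ 0 → 0 < inner ℝ (S t v) v := fun t ht v hv ↦
    (hE t ht).2.metricOp_pos hdata.star_p hdata.p_mul_self (hH t ht).1.1 (hHp t ht) hv
  -- A metric is also needed at negative times, where `H` is not known to be invertible.
  let g : ℝ → Metric E G := fun t ↦ hfr.metric (S (max t 0)) (hSstar _ (le_max_right t 0))
    (hSpos _ (le_max_right t 0))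
  have hg : ∀ t, 0 ≤ t → ∀ (x : G) (v w : TangentSpace 𝓘(ℝ, E) x),
      (g t).inner x v w = inner ℝ (S t (leftFraming φ x v)) (leftFraming φ x w) := by
    intro t ht x v w
    change inner ℝ (S (max t 0) _) _ = _
    rw [max_eq_left ht]
    rfl
  refine ⟨g, ?_, ?_, ?_, ?_, ?_⟩
  · have hinner : (g 0).inner = g₀.inner := by
      funext x
      ext v w
      rw [hg 0 le_rfl, hgφ]
      simp [S, metricOp, hH0]
    cases hg0 : g 0
    cases g₀
    rw [hg0] at hinner
    simp only at hinner
    subst hinner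
    rfl
  · intro t ht a x v w
    rw [hg t ht, hg t ht, leftFraming_mul, leftFraming_mul]
  · intro t ht x v w
    rw [hg t ht, hg t ht, hJθ, hJθ]
    have hSJ : Commute (S t) JV := by
      have hpJ : Commute p JV := hdata.J_comm.symm
      exact (((Commute.one_left JV).sub_left hpJ).mul_left (hHJ t ht)).add_left
        (hpJ.mul_left ((hE t ht).2.commute_inverse (hHJ t ht)))
    have h1 : ∀ a, S t (JV a) = JV (S t a) := fun a ↦ congr($(hSJ.eq) a)
    have h2 : ∀ a, JV (JV a) = -a := fun a ↦ congr($(hdata.J_mul_self) a)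
    rw [h1, ← ContinuousLinearMap.adjoint_inner_right, ← ContinuousLinearMap.star_eq_adjoint,
      hdata.star_J, neg_apply, h2, neg_neg]
  · intro x v w
    have hX : ContDiffOn ℝ ∞ (fun t ↦ Ring.inverse (H t)) (Ici 0) := fun t ht ↦ by
      obtain ⟨u, hu⟩ := (hE t ht).1
      have := contDiffAt_ringInverse ℝ (n := ∞) u
      rw [hu] at this
      exact this.comp_contDiffWithinAt t (hHs t ht)
    have hS : ContDiffOn ℝ ∞ S (Ici 0) :=
      (contDiffOn_const.mul hHs).add (contDiffOn_const.mul hX)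
    refine ContDiffOn.congr (f := fun t ↦ inner ℝ (S t (leftFraming φ x v)) (leftFraming φ x w)) ?_
      fun t ht ↦ hg t ht x v w
    exact (hS.clm_apply contDiffOn_const).inner ℝ contDiffOn_const
  · intro t ht
    obtain ⟨Ric, hRic, hval⟩ := hfr.exists_isRicciTensor hdata.skew (hSstar t ht) (hSpos t ht)
      (metricOp_mul hdata.p_mul_self (hE t ht).2.mul_right (hE t ht).2.mul_left (hHp t ht)
        ((hE t ht).2.commute_inverse (hHp t ht)))
    refine ⟨Ric, ?_, fun x v w ↦ ?_⟩
    · have : g t = hfr.metric (S t) (hSstar t ht) (hSpos t ht) := by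
        simp only [g, max_eq_left ht]
      rwa [this]
    · have h := (hdata.hasDerivAt_metricOp (hH t ht).1 (hH t ht).2
        (leftFraming φ x v) (leftFraming φ x w)).hasDerivWithinAt (s := Ici 0)
      rw [← hJθ, ← hJθ, ← hval, ← hval] at h
      exact h.congr (fun s hs ↦ hg s hs x v w) (hg t ht x v w)

end HermitianFlow

theorem mainTheorem4
    {E : Type*} [NormedAddCommGroup E] [NormedSpace ℝ E] [FiniteDimensional ℝ E] [CompleteSpace E]
    {G : Type*} [TopologicalSpace G] [ChartedSpace E G] [Group G] [LieGroup 𝓘(ℝ, E) ∞ G]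
    [SimplyConnectedSpace G]
    -- the Lie algebra of `G` is 2-step nilpotent: `[[𝔤, 𝔤], 𝔤] = 0`
    (hnil : LieModule.lowerCentralSeries ℝ (GroupLieAlgebra 𝓘(ℝ, E) G)
      (GroupLieAlgebra 𝓘(ℝ, E) G) 2 = ⊥)
    (J : Π x : G, TangentSpace 𝓘(ℝ, E) x →L[ℝ] TangentSpace 𝓘(ℝ, E) x)
    (hJ : HermitianFlow.IsComplexStructure J)
    (hJinv : HermitianFlow.IsLeftInvariantEndo J)
    -- `J` preserves the commutator ideal `[𝔤, 𝔤]`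
    (hJcomm : ∀ v : GroupLieAlgebra 𝓘(ℝ, E) G,
      v ∈ ⁅(⊤ : LieIdeal ℝ (GroupLieAlgebra 𝓘(ℝ, E) G)),
        (⊤ : LieIdeal ℝ (GroupLieAlgebra 𝓘(ℝ, E) G))⁆ →
      J 1 v ∈ ⁅(⊤ : LieIdeal ℝ (GroupLieAlgebra 𝓘(ℝ, E) G)),
        (⊤ : LieIdeal ℝ (GroupLieAlgebra 𝓘(ℝ, E) G))⁆)
    (g₀ : HermitianFlow.Metric E G)
    (hg₀inv : HermitianFlow.IsLeftInvariantMetric g₀)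
    (hg₀herm : HermitianFlow.IsHermitian J g₀) :
    ∃ g : ℝ → HermitianFlow.Metric E G,
      g 0 = g₀ ∧
      (∀ t : ℝ, 0 ≤ t → HermitianFlow.IsLeftInvariantMetric (g t)) ∧
      HermitianFlow.IsLongTimeSolution J g := by
  obtain ⟨φ, hφ⟩ := HermitianFlow.exists_frame_of_metric g₀ (1 : G)
  exact HermitianFlow.exists_isLongTimeSolution hnil J hJ hJinv hJcomm g₀ hg₀inv hg₀herm φ hφ
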